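/- **Setting.** Let $A\in\mathbb R^{d_x\times d_x}$, $B\in\mathbb R^{d_x\times d_u}$, $d=\max(d_x,d_u)$, and consider the known linear dynamical system $x_1=0$, $x_{t+1}=Ax_t+Bu_t+w_t$ ($t\ge 1$); $\|\cdot\|$ is the Euclidean norm of vectors and the spectral norm of matrices. Let $\kappa\ge 1$, $0<\gamma<1$, $\sigma>0$, $\alpha>0$ and $T\ge 1$. Assume: * $\|B\|\le\kappa_B$; the noise vectors $w_t$ are i.i.d. with law $\mathcal D$, $\mathbb E[w_t]=0$, $\mathbb E[w_tw_t^\top]\succeq\sigma^2I$, and $\|w_t\|\le W$ almost surely. * The (fixed, deterministic) cost functions $c_1,\dots,c_T:\mathbb R^{d_x}\times\mathbb R^{d_u}\to\mathbb R$ are differentiable and $\alpha$-strongly convex, and for every $D$ and all $\|x\|,\|u\|\le D$ one has $\|\nabla_xc_t(x,u)\|,\|\nabla_uc_t(x,u)\|\le GD$. A matrix $K\in\mathbb R^{d_u\times d_x}$ is $(\kappa,\gamma)$-diagonal strongly stable if $A-BK=QLQ^{-1}$ for a complex diagonal matrix $L$ and a non-singular complex matrix $Q$ with $\|L\|\le 1-\gamma$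 and $\|K\|,\|Q\|,\|Q^{-1}\|\le\kappa$. Let $\mathcal K$ be the set of these matrices. For a controller $\mathcal A$ put $J_T(\mathcal A)=\mathbb E\big[\sum_{t=1}^Tc_t(x_t,u_t)\big]$, and write $J_T(K)$ for the cost of $u_t=-Kx_t$. **Algorithm.** Fix $\mathbb K\in\mathcal K$, put $H=\lceil\gamma^{-1}\log(T\kappa^2)\rceil$, $\tilde A=A-B\mathbb K$ and $$\mathcal M=\Big\{M=(M^{[0]},\dots,M^{[H-1]}),\ M^{[i]}\in\mathbb R^{d_u\times d_x}:\ \|M^{[i-1]}\|\le\max\big(\kappa^3\kappa_B(1-\gamma)^i,\ 2\kappa^3(1-\gamma)^{i-1}\big),\ 1\le i\le H\Big\}.$$ With $w_0,\dots,w_{2H}$ here denoting independent vectors of law $\mathcal D$, put $$\Psi_i(M)=\tilde A^i\mathbf 1_{i\le H}+\sum_{j=0}^H\tilde A^jBM^{[i-j-1]}\mathbf 1_{1\le i-j\le H},\qquad y(M)=\sum_{i=0}^{2H}\Psi_i(M)\,w_{2H-i},$$ $$v(M)=-\mathbb Ky(M)+\sum_{i=1}^HM^{[i-1]}w_{2H+1-i},\qquad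 f_t(M)=\mathbb E\big[c_t(y(M),v(M))\big].$$ Starting from an arbitrary $M_1\in\mathcal M$, the algorithm $\mathcal A$ plays $u_t=-\mathbb Kx_t+\sum_{i=1}^HM_t^{[i-1]}w_{t-i}$ (with $w_s=0$ for $s<1$) and updates $M_{t+1}=\Pi_{\mathcal M}\big(M_t-\eta_t\nabla f_t(M_t)\big)$, where gradient and nearest-point projection $\Pi_{\mathcal M}$ refer to the Euclidean (Frobenius) structure on the entries of $M$. **Theorem.** There are two universal polynomials $p,q$ in four variables such that, in the above setting, for every $\theta\ge p(\gamma^{-1},\kappa_B,\kappa,d)$, every $\mathbb K\in\mathcal K$ and every $M_1\in\mathcal M$, the algorithm with step sizes $\eta_t=\theta/(\alpha\sigma^2t)$ satisfies $$J_T(\mathcal A)-J_T(K)\ \le\ q(\gamma^{-1},\kappa_B,\kappa,d)\;\theta\;\frac{G^2W^4}{\alpha\sigma^2}\,\log^7T\qquad\text{for every }K\in\mathcal K .$$ In particular, for $\theta=p(\gamma^{-1},\kappa_B,\kappa,d)$, the regret against the best controller in $\mathcal K$ is $O\big(\tfrac{G^2W^4}{\alpha\sigma^2}\log^7T\big)$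 up to factors polynomial in $\gamma^{-1},\kappa_B,\kappa,d$. -/

import Mathlib

open MeasureTheory ProbabilityTheory
open scoped Matrix

noncomputable section

namespace OnlineControl

/-- The spectral norm: the operator norm with respect to the Euclidean norms. -/
def specNorm {𝕜 : Type*} [RCLike 𝕜] {m n : ℕ} (A : Matrix (Fin m) (Fin n) 𝕜) : ℝ :=
  ‖(Matrix.toEuclideanLin A).toContinuousLinearMap‖

/-- `(κ, γ)`-diagonal strong stability of the linear policy `u = -K x` for the dynamics `(A, B)`:
`A - B K = Q L Q⁻¹` with `L` complex diagonal and `Q` complex and non-singular. -/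
def DiagStronglyStable {dx du : ℕ} (A : Matrix (Fin dx) (Fin dx) ℝ)
    (B : Matrix (Fin dx) (Fin du) ℝ) (κ γ : ℝ) (K : Matrix (Fin du) (Fin dx) ℝ) : Prop :=
  ∃ (l : Fin dx → ℂ) (Q : Matrix (Fin dx) (Fin dx) ℂ),
    IsUnit Q ∧
    (A - B * K).map (algebraMap ℝ ℂ) = Q * Matrix.diagonal l * Q⁻¹ ∧
    specNorm (Matrix.diagonal l) ≤ 1 - γ ∧
    specNorm K ≤ κ ∧ specNorm Q ≤ κ ∧ specNorm Q⁻¹ ≤ κ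

/-- The noise distribution has mean zero, covariance at least `σ² I`, and is bounded by `W`. -/
structure NoiseLaw {dx : ℕ} (𝒟 : Measure (EuclideanSpace ℝ (Fin dx))) (σ W : ℝ) : Prop where
  prob : IsProbabilityMeasure 𝒟
  mean_zero : ∫ x, x ∂𝒟 = 0
  cov : (Matrix.of (fun i j : Fin dx => ∫ x, x i * x j ∂𝒟) -
    σ ^ 2 • (1 : Matrix (Fin dx) (Fin dx) ℝ)).PosSemidef
  bounded : ∀ᵐ x ∂𝒟, ‖x‖ ≤ W

/-- The cost is differentiable, `α`-strongly convex in `(x, u)` for the Euclidean norm, and its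
partial gradients are at most `G D` on `‖x‖, ‖u‖ ≤ D`, for every `D`. -/
structure CostClass {dx du : ℕ} (α G : ℝ)
    (c : EuclideanSpace ℝ (Fin dx) → EuclideanSpace ℝ (Fin du) → ℝ) : Prop where
  diff : Differentiable ℝ
    (fun z : EuclideanSpace ℝ (Fin dx) × EuclideanSpace ℝ (Fin du) => c z.1 z.2)
  strong : StrongConvexOn Set.univ α
    (fun z : WithLp 2 (EuclideanSpace ℝ (Fin dx) × EuclideanSpace ℝ (Fin du)) => c z.fst z.snd)
  grad_x : ∀ (D : ℝ) (x : EuclideanSpace ℝ (Fin dx)) (u : EuclideanSpace ℝ (Fin du)),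
    ‖x‖ ≤ D → ‖u‖ ≤ D → ‖gradient (fun x' => c x' u) x‖ ≤ G * D
  grad_u : ∀ (D : ℝ) (x : EuclideanSpace ℝ (Fin dx)) (u : EuclideanSpace ℝ (Fin du)),
    ‖x‖ ≤ D → ‖u‖ ≤ D → ‖gradient (fun u' => c x u') u‖ ≤ G * D

/-- Parameters `M = (M^[0], …, M^[H-1])` of a disturbance-action policy, as one flattened vector;
norm, gradient and projection are those of this Euclidean space. -/
abbrev Params (H du dx : ℕ) : Type := EuclideanSpace ℝ (Fin H × Fin du × Fin dx)

/-- The matrix `M^[i]`, and `0` if `i ≥ H`. -/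
def blk {H du dx : ℕ} (M : Params H du dx) (i : ℕ) : Matrix (Fin du) (Fin dx) ℝ :=
  if h : i < H then Matrix.of (fun a b => M (⟨i, h⟩, a, b)) else 0

/-- The horizon `γ⁻¹ log (T κ²)`, rounded up. -/
def horizon (κ γ : ℝ) (T : ℕ) : ℕ := ⌈γ⁻¹ * Real.log (T * κ ^ 2)⌉₊

/-- The feasible set of the parameters. The bound on the `i`-th block (`1 ≤ i ≤ H`) is
`max (κ³ κ_B (1 - γ)^i) (2 κ³ (1 - γ)^(i-1))`; blocks are counted from `0` here. -/
def feasible (H du dx : ℕ) (κB κ γ : ℝ) : Set (Params H du dx) :=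
  {M | ∀ i < H, specNorm (blk M i) ≤
    max (κ ^ 3 * κB * (1 - γ) ^ (i + 1)) (2 * κ ^ 3 * (1 - γ) ^ i)}

section System

variable {dx du : ℕ} (A : Matrix (Fin dx) (Fin dx) ℝ) (B : Matrix (Fin dx) (Fin du) ℝ)

/-- The states of `x_{t+1} = A x_t + B u_t + w_t` from `x_1 = 0` (time starts at `1`), where
`u_t = π t x_t`. -/
def states (π : ℕ → EuclideanSpace ℝ (Fin dx) → EuclideanSpace ℝ (Fin du))
    (w : ℕ → EuclideanSpace ℝ (Fin dx)) : ℕ → EuclideanSpace ℝ (Fin dx)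
  | 0 => 0
  | 1 => 0
  | t + 2 => A.toEuclideanLin (states π w (t + 1))
      + B.toEuclideanLin (π (t + 1) (states π w (t + 1))) + w (t + 1)

/-- The linear controller `u = -K x`. -/
def linearPolicy (K : Matrix (Fin du) (Fin dx) ℝ) (_t : ℕ) (x : EuclideanSpace ℝ (Fin dx)) :
    EuclideanSpace ℝ (Fin du) :=
  -K.toEuclideanLin x

/-- The disturbance-action controller with parameters `M t` at time `t`:
`u_t = -𝕂 x_t + ∑_{i=1}^H M_t^[i-1] w_{t-i}`, with `w_s = 0` before the start (`s < 1`). -/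
def dapPolicy {H : ℕ} (𝕂 : Matrix (Fin du) (Fin dx) ℝ) (M : ℕ → Params H du dx)
    (w : ℕ → EuclideanSpace ℝ (Fin dx)) (t : ℕ) (x : EuclideanSpace ℝ (Fin dx)) :
    EuclideanSpace ℝ (Fin du) :=
  -𝕂.toEuclideanLin x + ∑ i ∈ Finset.Icc 1 H,
    if i < t then (blk (M t) (i - 1)).toEuclideanLin (w (t - i)) else 0

/-- The expected total cost `E [∑_{t=1}^T c_t(x_t, u_t)]` of the controller `π`, which may depend on
the noise sequence. -/
def expectedCost {Ω : Type*} [MeasurableSpace Ω] (P : Measure Ω)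
    (w : ℕ → Ω → EuclideanSpace ℝ (Fin dx))
    (c : ℕ → EuclideanSpace ℝ (Fin dx) → EuclideanSpace ℝ (Fin du) → ℝ) (T : ℕ)
    (π : (ℕ → EuclideanSpace ℝ (Fin dx)) → ℕ → EuclideanSpace ℝ (Fin dx) →
      EuclideanSpace ℝ (Fin du)) : ℝ :=
  ∫ ω, ∑ t ∈ Finset.Icc 1 T,
    (let v : ℕ → EuclideanSpace ℝ (Fin dx) := fun s => w s ω
     let x := states A B (π v) v t
     c t x (π v t x)) ∂P

variable (𝕂 : Matrix (Fin du) (Fin dx) ℝ)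

/-- The disturbance-state transfer matrix `Ψ_i(M_{0:H})`, for `0 ≤ i ≤ 2H`. -/
def transfer {H : ℕ} (M : ℕ → Params H du dx) (i : ℕ) : Matrix (Fin dx) (Fin dx) ℝ :=
  (if i ≤ H then (A - B * 𝕂) ^ i else 0) +
    ∑ j ∈ Finset.range (H + 1),
      if j + 1 ≤ i ∧ i ≤ j + H then (A - B * 𝕂) ^ j * B * blk (M (H - j)) (i - j - 1) else 0

/-- The surrogate state `y(M_{0:H}) = ∑_{i=0}^{2H} Ψ_i(M_{0:H}) w_{2H-i}`. -/
def surrogateState {H : ℕ} (M : ℕ → Params H du dx)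
    (w : Fin (2 * H + 1) → EuclideanSpace ℝ (Fin dx)) : EuclideanSpace ℝ (Fin dx) :=
  ∑ i : Fin (2 * H + 1), (transfer A B 𝕂 M i).toEuclideanLin (w i.rev)

/-- The surrogate action
`v(M_{0:H+1}) = -𝕂 y(M_{0:H}) + ∑_{i=1}^H M_{H+1}^[i-1] w_{2H+1-i}`. -/
def surrogateAction {H : ℕ} (M : ℕ → Params H du dx)
    (w : Fin (2 * H + 1) → EuclideanSpace ℝ (Fin dx)) : EuclideanSpace ℝ (Fin du) :=
  -𝕂.toEuclideanLin (surrogateState A B 𝕂 M w) +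
    ∑ i : Fin H, (blk (M (H + 1)) i).toEuclideanLin (w (Fin.rev ⟨i, by omega⟩))

/-- The surrogate cost `f(M) = E [c(y(M, …, M), v(M, …, M))]` over independent noise vectors with
law `𝒟`. -/
def surrogateCost {H : ℕ} (𝒟 : Measure (EuclideanSpace ℝ (Fin dx)))
    (c : EuclideanSpace ℝ (Fin dx) → EuclideanSpace ℝ (Fin du) → ℝ) (M : Params H du dx) : ℝ :=
  ∫ w, c (surrogateState A B 𝕂 (fun _ => M) w) (surrogateAction A B 𝕂 (fun _ => M) w)
    ∂(Measure.pi fun _ : Fin (2 * H + 1) => 𝒟)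

/-- `M_1, …, M_T` are iterates of projected online gradient descent on the surrogate costs with
step sizes `η_t`: `M_1` is an arbitrary feasible point and `M_{t+1}` is the point of the feasible
set nearest to `M_t - η_t ∇ f_t(M_t)`. -/
def IsGradientRun {H : ℕ} (κB κ γ : ℝ) (𝒟 : Measure (EuclideanSpace ℝ (Fin dx)))
    (c : ℕ → EuclideanSpace ℝ (Fin dx) → EuclideanSpace ℝ (Fin du) → ℝ) (T : ℕ) (η : ℕ → ℝ)
    (M : ℕ → Params H du dx) : Prop :=
  M 1 ∈ feasible H du dx κB κ γ ∧
  ∀ t, 1 ≤ t → t < T →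
    M (t + 1) ∈ feasible H du dx κB κ γ ∧
    dist (M t - η t • gradient (surrogateCost A B 𝕂 𝒟 (c t)) (M t)) (M (t + 1)) =
      Metric.infDist (M t - η t • gradient (surrogateCost A B 𝕂 𝒟 (c t)) (M t))
        (feasible H du dx κB κ γ)

end System

end OnlineControl

end

/-! The regret splits into three sums. Let `N = imitation A B 𝕂 K H`, with blocks `(𝕂 - K)(A -
BK)^i`, be the disturbance-action surrogate of `K`. Then `J_T(𝒜) - J_T(K)` is the sum over `t` of `E
c_t(x_t, u_t) - f_t(M_t)`, of `f_t(M_t) - f_t(N)`, and of `f_t(N) - E c_t(x_t^K, u_t^K)`. Since each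
`f_t` is an expectation, the iterates `M_t` are deterministic, and `f_t(M_t)` is the expected cost
of the surrogate state and action of `M_t` built from the last `2H + 1` noise vectors
(`surrogateCost_eq_expectation`).

Third sum: unrolling the closed loop of `K` shows that it differs from the surrogate of `N` by terms
of size `κ²(1-γ)^H ≤ 1/T` (`linear_compare`). First sum: besides this truncation error there is the
drift of `M_s` over a window of `H + 1` steps; steps are of order `1/t`, so the drift sums to a
logarithm (`dap_compare`, `norm_iterate_sub_le`). In both sums the first `2H + 1` steps are bounded
crudely.

Second sum: online gradient descent with steps of order `1/t` has logarithmic regret on strongly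
convex losses (`gradient_descent_regret`). The decisive point is that `f_t` is strongly convex in
`M` with modulus `ασ²/(2κ²)`. State `y` and action `v` are affine in `M`, and `v + 𝕂 y` is the
feedforward term `∑ M^[k] w_{t-1-k}`. Hence a change of `M` that alters the feedforward must alter
`(y, v)`, losing only a factor `2κ²` (`norm_feedforward_sub_sq_le`); and independent noise of
covariance at least `σ²I` makes the mean square of the feedforward of `M - N` at least `σ²‖M - N‖²`
(`le_integral_feedforward_sq`). So `θ ≥ 2κ²` suffices for the step sizes.

The gradient bound carries one factor `H` and the drift two more, and `H` is of order `log T`, so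
the bound has order `log⁴ T`; lower powers are padded to the seventh. The inequalities `α ≤ 6G` and
`σ ≤ W` bring terms of size `GW²` to the scale `G²W⁴/(ασ²)`. -/

noncomputable section

namespace OnlineControl

/-! ### Spectral norm of matrices -/

section SpecNorm

variable {𝕜 : Type*} [RCLike 𝕜] {l m n : ℕ}

lemma specNorm_nonneg (A : Matrix (Fin m) (Fin n) 𝕜) : 0 ≤ specNorm A := norm_nonneg _

lemma norm_toEuclideanLin_le (A : Matrix (Fin m) (Fin n) 𝕜) (x : EuclideanSpace 𝕜 (Fin n)) :
    ‖A.toEuclideanLin x‖ ≤ specNorm A * ‖x‖ :=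
  (Matrix.toEuclideanLin A).toContinuousLinearMap.le_opNorm x

lemma specNorm_le {A : Matrix (Fin m) (Fin n) 𝕜} {C : ℝ} (hC : 0 ≤ C)
    (h : ∀ x, ‖A.toEuclideanLin x‖ ≤ C * ‖x‖) : specNorm A ≤ C :=
  ContinuousLinearMap.opNorm_le_bound _ hC h

lemma norm_toEuclideanLin_le_of_le {A : Matrix (Fin m) (Fin n) 𝕜} {C : ℝ} (h : specNorm A ≤ C)
    (x : EuclideanSpace 𝕜 (Fin n)) : ‖A.toEuclideanLin x‖ ≤ C * ‖x‖ :=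
  (norm_toEuclideanLin_le A x).trans (mul_le_mul_of_nonneg_right h (norm_nonneg x))

lemma toEuclideanLin_mul_apply (A : Matrix (Fin l) (Fin m) 𝕜) (B : Matrix (Fin m) (Fin n) 𝕜)
    (x : EuclideanSpace 𝕜 (Fin n)) :
    (A * B).toEuclideanLin x = A.toEuclideanLin (B.toEuclideanLin x) := by
  simp

lemma specNorm_add_le (A B : Matrix (Fin m) (Fin n) 𝕜) :
    specNorm (A + B) ≤ specNorm A + specNorm B := by
  unfold specNorm
  rw [map_add, map_add]
  exact norm_add_le _ _

lemma specNorm_smul (c : 𝕜) (A : Matrix (Fin m) (Fin n) 𝕜) :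
    specNorm (c • A) = ‖c‖ * specNorm A := by
  unfold specNorm
  rw [map_smul, map_smul, norm_smul]

lemma specNorm_neg (A : Matrix (Fin m) (Fin n) 𝕜) : specNorm (-A) = specNorm A := by
  unfold specNorm
  rw [map_neg, map_neg, norm_neg]

lemma specNorm_sub_le (A B : Matrix (Fin m) (Fin n) 𝕜) :
    specNorm (A - B) ≤ specNorm A + specNorm B := by
  rw [sub_eq_add_neg, ← specNorm_neg B]
  exact specNorm_add_le _ _

lemma norm_toEuclideanLin_pow_le {A : Matrix (Fin n) (Fin n) 𝕜} {C : ℝ} (h : specNorm A ≤ C)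
    (i : ℕ) (x : EuclideanSpace 𝕜 (Fin n)) :
    ‖(A ^ i).toEuclideanLin x‖ ≤ C ^ i * ‖x‖ := by
  have hC : 0 ≤ C := (specNorm_nonneg A).trans h
  induction i with
  | zero => simp
  | succ i ih =>
    rw [pow_succ', toEuclideanLin_mul_apply, pow_succ', mul_assoc]
    exact (norm_toEuclideanLin_le_of_le h _).trans (mul_le_mul_of_nonneg_left ih hC)

/-- Cauchy–Schwarz in each row. It links the Euclidean structure on parameters, used by gradient
descent, to their action on noise vectors. -/
lemma norm_toEuclideanLin_le_frobenius (A : Matrix (Fin m) (Fin n) ℝ)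
    (x : EuclideanSpace ℝ (Fin n)) :
    ‖A.toEuclideanLin x‖ ≤ √(∑ a, ∑ b, A a b ^ 2) * ‖x‖ := by
  rw [EuclideanSpace.norm_eq, EuclideanSpace.norm_eq, ← Real.sqrt_mul (by positivity)]
  apply Real.sqrt_le_sqrt
  rw [Finset.sum_mul]
  refine Finset.sum_le_sum fun a _ => ?_
  have : (A.toEuclideanLin x) a = ∑ b, A a b * x b := rfl
  rw [this, Real.norm_eq_abs, sq_abs]
  refine (Finset.sum_mul_sq_le_sq_mul_sq _ _ _).trans (le_of_eq ?_)
  simp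

end SpecNorm

/-! ### Powers of a stable closed loop and the choice of horizon -/

section Stability

variable {dx du : ℕ} {A : Matrix (Fin dx) (Fin dx) ℝ} {B : Matrix (Fin dx) (Fin du) ℝ}
  {κ γ : ℝ} {K : Matrix (Fin du) (Fin dx) ℝ}

/-- The coordinatewise embedding of real into complex Euclidean space. -/
def complexify {n : ℕ} (x : EuclideanSpace ℝ (Fin n)) : EuclideanSpace ℂ (Fin n) :=
  WithLp.toLp 2 (fun i => (x i : ℂ))

lemma norm_complexify {n : ℕ} (x : EuclideanSpace ℝ (Fin n)) : ‖complexify x‖ = ‖x‖ := by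
  simp [complexify, EuclideanSpace.norm_eq]

lemma complexify_toEuclideanLin {m n : ℕ} (A : Matrix (Fin m) (Fin n) ℝ)
    (x : EuclideanSpace ℝ (Fin n)) :
    complexify (A.toEuclideanLin x) =
      (A.map (algebraMap ℝ ℂ)).toEuclideanLin (complexify x) := by
  ext i
  simp [complexify, Matrix.mulVec, dotProduct]

lemma mul_mul_inv_pow {n : ℕ} {Q L : Matrix (Fin n) (Fin n) ℂ} (hQ : IsUnit Q) (i : ℕ) :
    (Q * L * Q⁻¹) ^ i = Q * L ^ i * Q⁻¹ := by
  have hdet := (Matrix.isUnit_iff_isUnit_det Q).mp hQ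
  induction i with
  | zero => simp [Matrix.mul_nonsing_inv Q hdet]
  | succ i ih =>
    have h : Q⁻¹ * (Q * L) = L := by
      rw [← mul_assoc, Matrix.nonsing_inv_mul Q hdet, one_mul]
    rw [pow_succ, ih, pow_succ]
    simp only [mul_assoc]
    rw [← mul_assoc Q L, ← mul_assoc Q⁻¹ (Q * L), h]

/-- In `(Q L Q⁻¹)^i = Q L^i Q⁻¹` the conjugation is paid for once, hence a factor `κ²` independent
of `i`. The diagonalisation is complex, and embedding real vectors into complex ones preserves the
norm. -/
lemma DiagStronglyStable.norm_pow_le (h : DiagStronglyStable A B κ γ K) (hκ : 1 ≤ κ) (i : ℕ)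
    (x : EuclideanSpace ℝ (Fin dx)) :
    ‖((A - B * K).toEuclideanLin ^ i) x‖ ≤ κ ^ 2 * (1 - γ) ^ i * ‖x‖ := by
  obtain ⟨l, Q, hQ, hA, hl, -, hQn, hQi⟩ := h
  have hγ : 0 ≤ 1 - γ := (specNorm_nonneg _).trans hl
  have e : ((A - B * K).toEuclideanLin ^ i) x = ((A - B * K) ^ i).toEuclideanLin x := by
    rw [Matrix.toLpLin_pow]
  have e2 : ((A - B * K) ^ i).map (algebraMap ℝ ℂ) = Q * Matrix.diagonal l ^ i * Q⁻¹ := by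
    rw [← mul_mul_inv_pow hQ, ← hA]
    exact map_pow (RingHom.mapMatrix (algebraMap ℝ ℂ)) _ _
  rw [e, ← norm_complexify, complexify_toEuclideanLin, e2, toEuclideanLin_mul_apply,
    toEuclideanLin_mul_apply]
  calc _ ≤ κ * _ := norm_toEuclideanLin_le_of_le hQn _
    _ ≤ κ * ((1 - γ) ^ i * (κ * ‖complexify x‖)) := by
        gcongr
        refine (norm_toEuclideanLin_pow_le hl i _).trans ?_
        gcongr
        exact norm_toEuclideanLin_le_of_le hQi _
    _ = _ := by rw [norm_complexify]; ring

lemma sum_one_sub_pow_le (hγ : 0 < γ) (hγ1 : γ < 1) (n : ℕ) :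
    ∑ i ∈ Finset.range n, (1 - γ) ^ i ≤ γ⁻¹ := by
  have h := Summable.sum_le_tsum (f := fun i : ℕ => (1 - γ) ^ i) (Finset.range n)
    (fun i _ => pow_nonneg (by linarith) i)
    (summable_geometric_of_lt_one (by linarith) (by linarith))
  rwa [tsum_geometric_of_lt_one (by linarith) (by linarith), sub_sub_cancel] at h

/-- `(1-γ)^H ≤ exp(-γH)`, and the horizon is the least integer `H` with `γH ≥ log(Tκ²)`: truncation
then costs `1/T` per step. -/
lemma one_sub_pow_horizon_le (hκ : 1 ≤ κ) (hγ : 0 < γ) (hγ1 : γ < 1) {T : ℕ} (hT : 1 ≤ T) :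
    κ ^ 2 * (1 - γ) ^ horizon κ γ T ≤ 1 / T := by
  have hT' : (0 : ℝ) < T := by exact_mod_cast hT
  have hκ0 : 0 < κ := by linarith
  have hH : Real.log (T * κ ^ 2) ≤ γ * horizon κ γ T := by
    have := Nat.le_ceil (γ⁻¹ * Real.log (T * κ ^ 2))
    rw [inv_mul_le_iff₀ hγ] at this
    exact this
  have h1 : (1 - γ) ^ horizon κ γ T ≤ Real.exp (-γ) ^ horizon κ γ T := by
    apply pow_le_pow_left₀ (by linarith)
    have := Real.add_one_le_exp (-γ)
    linarith
  have h2 : Real.exp (-γ) ^ horizon κ γ T ≤ (T * κ ^ 2)⁻¹ := by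
    rw [← Real.exp_nat_mul, ← Real.exp_log (show 0 < ((T : ℝ) * κ ^ 2)⁻¹ by positivity),
      Real.log_inv]
    apply Real.exp_le_exp.mpr
    linarith
  calc κ ^ 2 * (1 - γ) ^ horizon κ γ T ≤ κ ^ 2 * ((T : ℝ) * κ ^ 2)⁻¹ := by
        gcongr; exact h1.trans h2
    _ = 1 / (T : ℝ) := by field_simp

end Stability

/-! ### Perturbed linear recursions -/

section Recursion

variable {F : Type*} [NormedAddCommGroup F] [NormedSpace ℝ F] {L : F →ₗ[ℝ] F}

/-- Variation of constants from any starting time: from time `1` it yields uniform bounds, from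
about `H` steps back it yields truncation errors. -/
lemma linear_recursion_unroll {x e : ℕ → F} (h : ∀ t, 1 ≤ t → x (t + 1) = L (x t) + e t)
    {s : ℕ} (hs : 1 ≤ s) (n : ℕ) :
    x (s + n) = (L ^ n) (x s) + ∑ i ∈ Finset.range n, (L ^ i) (e (s + n - 1 - i)) := by
  induction n with
  | zero => simp
  | succ n ih =>
    rw [← add_assoc, h _ (by omega), ih, Finset.sum_range_succ', map_add, map_sum, pow_succ',
      add_assoc]
    congr 2
    refine Finset.sum_congr rfl fun i _ => ?_
    rw [pow_succ', Module.End.mul_apply]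
    congr 3
    omega

lemma norm_sum_pow_le {C γ Z : ℝ} (hC : 0 ≤ C) (hγ : 0 < γ) (hγ1 : γ < 1) (hZ : 0 ≤ Z)
    (hL : ∀ (i : ℕ) (z : F), ‖(L ^ i) z‖ ≤ C * (1 - γ) ^ i * ‖z‖) {n : ℕ} {z : ℕ → F}
    (hz : ∀ i < n, ‖z i‖ ≤ Z) :
    ‖∑ i ∈ Finset.range n, (L ^ i) (z i)‖ ≤ C * γ⁻¹ * Z := by
  have hγ' : 0 ≤ 1 - γ := by linarith
  calc _ ≤ ∑ i ∈ Finset.range n, C * (1 - γ) ^ i * Z := by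
        refine norm_sum_le_of_le _ fun i hi => (hL i _).trans ?_
        have := hz i (Finset.mem_range.mp hi)
        gcongr
    _ = C * (∑ i ∈ Finset.range n, (1 - γ) ^ i) * Z := by
        rw [Finset.mul_sum, Finset.sum_mul]
    _ ≤ _ := by
        gcongr
        exact sum_one_sub_pow_le hγ hγ1 n

lemma norm_linear_recursion_le {C γ Z : ℝ} (hC : 0 ≤ C) (hγ : 0 < γ) (hγ1 : γ < 1) (hZ : 0 ≤ Z)
    (hL : ∀ (i : ℕ) (z : F), ‖(L ^ i) z‖ ≤ C * (1 - γ) ^ i * ‖z‖) {x e : ℕ → F}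
    (h : ∀ t, 1 ≤ t → x (t + 1) = L (x t) + e t) (hx : x 1 = 0) {t : ℕ} (ht : 1 ≤ t)
    (he : ∀ s, 1 ≤ s → s < t → ‖e s‖ ≤ Z) : ‖x t‖ ≤ C * γ⁻¹ * Z := by
  obtain ⟨n, rfl⟩ := Nat.exists_eq_add_of_le ht
  rw [linear_recursion_unroll h le_rfl, hx, map_zero, zero_add]
  exact norm_sum_pow_le hC hγ hγ1 hZ hL fun i hi => he _ (by omega) (by omega)

end Recursion

/-! ### Disturbance-action parameters -/

section Blocks

variable {H du dx : ℕ}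

lemma blk_add (M N : Params H du dx) (i : ℕ) : blk (M + N) i = blk M i + blk N i := by
  unfold blk
  split_ifs
  · ext; simp
  · simp

lemma blk_smul (c : ℝ) (M : Params H du dx) (i : ℕ) : blk (c • M) i = c • blk M i := by
  unfold blk
  split_ifs
  · ext; simp
  · simp

lemma blk_sub (M N : Params H du dx) (i : ℕ) : blk (M - N) i = blk M i - blk N i := by
  unfold blk
  split_ifs
  · ext; simp
  · simp

lemma norm_sq_eq_sum_blk (M : Params H du dx) :
    ‖M‖ ^ 2 = ∑ k ∈ Finset.range H, ∑ a, ∑ b, blk M k a b ^ 2 := by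
  rw [EuclideanSpace.norm_sq_eq, Fintype.sum_prod_type, Finset.sum_range]
  refine Finset.sum_congr rfl fun k _ => ?_
  rw [Fintype.sum_prod_type]
  simp [blk]

lemma norm_blk_apply_le (M : Params H du dx) (i : ℕ) (x : EuclideanSpace ℝ (Fin dx)) :
    ‖(blk M i).toEuclideanLin x‖ ≤ ‖M‖ * ‖x‖ := by
  refine (norm_toEuclideanLin_le_frobenius _ _).trans ?_
  gcongr
  apply Real.sqrt_le_iff.mpr ⟨norm_nonneg _, ?_⟩
  by_cases hi : i < H
  · rw [norm_sq_eq_sum_blk]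
    exact Finset.single_le_sum (f := fun k => ∑ a, ∑ b, blk M k a b ^ 2)
      (fun k _ => by positivity) (Finset.mem_range.mpr hi)
  · simp [blk, hi]

lemma convex_feasible (κB κ γ : ℝ) : Convex ℝ (feasible H du dx κB κ γ) := by
  intro M hM N hN a b ha hb hab i hi
  rw [blk_add, blk_smul, blk_smul]
  refine (specNorm_add_le _ _).trans ?_
  rw [specNorm_smul, specNorm_smul, Real.norm_of_nonneg ha, Real.norm_of_nonneg hb]
  calc _ ≤ a * max (κ ^ 3 * κB * (1 - γ) ^ (i + 1)) (2 * κ ^ 3 * (1 - γ) ^ i) +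
        b * max (κ ^ 3 * κB * (1 - γ) ^ (i + 1)) (2 * κ ^ 3 * (1 - γ) ^ i) :=
        add_le_add (mul_le_mul_of_nonneg_left (hM i hi) ha)
          (mul_le_mul_of_nonneg_left (hN i hi) hb)
    _ = _ := by rw [← add_mul, hab, one_mul]

/-- The feedforward part `∑_{k<H} M^[k] e_{s-1-k}` of a disturbance-action policy at time `s`. -/
def feedforward (M : Params H du dx) (e : ℕ → EuclideanSpace ℝ (Fin dx)) (s : ℕ) :
    EuclideanSpace ℝ (Fin du) :=
  ∑ k ∈ Finset.range H, (blk M k).toEuclideanLin (e (s - 1 - k))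

lemma feedforward_add (M N : Params H du dx) (e : ℕ → EuclideanSpace ℝ (Fin dx)) (s : ℕ) :
    feedforward (M + N) e s = feedforward M e s + feedforward N e s := by
  simp only [feedforward, blk_add, map_add, LinearMap.add_apply, Finset.sum_add_distrib]

lemma feedforward_smul (c : ℝ) (M : Params H du dx) (e : ℕ → EuclideanSpace ℝ (Fin dx)) (s : ℕ) :
    feedforward (c • M) e s = c • feedforward M e s := by
  simp only [feedforward, blk_smul, map_smul, LinearMap.smul_apply, Finset.smul_sum]

lemma feedforward_sub (M N : Params H du dx) (e : ℕ → EuclideanSpace ℝ (Fin dx)) (s : ℕ) :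
    feedforward (M - N) e s = feedforward M e s - feedforward N e s := by
  simp only [feedforward, blk_sub, map_sub, LinearMap.sub_apply, Finset.sum_sub_distrib]

/-- Meant for differences of parameters, whose blocks are controlled only through the total norm and
need not decay; hence the factor `H`. -/
lemma norm_feedforward_le {W : ℝ} {e : ℕ → EuclideanSpace ℝ (Fin dx)} (he : ∀ s, ‖e s‖ ≤ W)
    (M : Params H du dx) (s : ℕ) : ‖feedforward M e s‖ ≤ W * H * ‖M‖ := by
  calc _ ≤ ∑ _k ∈ Finset.range H, ‖M‖ * W := by
        refine norm_sum_le_of_le _ fun k _ => (norm_blk_apply_le M k _).trans ?_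
        gcongr
        exact he _
    _ = _ := by rw [Finset.sum_const, Finset.card_range, nsmul_eq_mul]; ring

end Blocks

/-- The assumptions on the dynamics and on the stabilizing policy `𝕂`. -/
structure StableSystem {dx du : ℕ} (A : Matrix (Fin dx) (Fin dx) ℝ)
    (B : Matrix (Fin dx) (Fin du) ℝ) (𝕂 : Matrix (Fin du) (Fin dx) ℝ) (κB κ γ : ℝ) : Prop where
  one_le : 1 ≤ κ
  pos : 0 < γ
  lt_one : γ < 1
  norm_B : specNorm B ≤ κB
  stable : DiagStronglyStable A B κ γ 𝕂

/-- `W * feedforwardGain` bounds the feedforward term of a feasible policy. -/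
def feedforwardGain (κB κ γ : ℝ) : ℝ := κ ^ 3 * (κB + 2) * γ⁻¹

/-- `W * stateGain` bounds all the states and actions. -/
def stateGain (κB κ γ : ℝ) : ℝ :=
  κ ^ 3 * γ⁻¹ * (1 + κB * feedforwardGain κB κ γ) + feedforwardGain κB κ γ

/-- The sensitivity of state and action to the feedforward terms. -/
def lipGain (κB κ γ : ℝ) : ℝ := (1 + κ) * (κ ^ 2 * γ⁻¹ * κB) + 1

/-! ### Surrogate states and actions -/

section Dynamics

variable {H dx du : ℕ} {A : Matrix (Fin dx) (Fin dx) ℝ} {B : Matrix (Fin dx) (Fin du) ℝ}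
  {𝕂 : Matrix (Fin du) (Fin dx) ℝ} {κB κ γ W : ℝ}

namespace StableSystem

lemma kappa_pos (S : StableSystem A B 𝕂 κB κ γ) : 0 < κ := zero_lt_one.trans_le S.one_le

lemma kappaB_nonneg (S : StableSystem A B 𝕂 κB κ γ) : 0 ≤ κB := (specNorm_nonneg B).trans S.norm_B

lemma inv_pos (S : StableSystem A B 𝕂 κB κ γ) : 0 < γ⁻¹ := _root_.inv_pos.mpr S.pos

lemma norm_gain (S : StableSystem A B 𝕂 κB κ γ) : specNorm 𝕂 ≤ κ := by
  obtain ⟨l, Q, -, -, -, h, -⟩ := S.stable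
  exact h

lemma norm_pow_le (S : StableSystem A B 𝕂 κB κ γ) (i : ℕ) (z : EuclideanSpace ℝ (Fin dx)) :
    ‖((A - B * 𝕂).toEuclideanLin ^ i) z‖ ≤ κ ^ 2 * (1 - γ) ^ i * ‖z‖ :=
  S.stable.norm_pow_le S.one_le i z

lemma feedforwardGain_nonneg (S : StableSystem A B 𝕂 κB κ γ) : 0 ≤ feedforwardGain κB κ γ := by
  have := S.kappa_pos
  have := S.kappaB_nonneg
  have := S.inv_pos
  unfold feedforwardGain
  positivity

lemma stateGain_pos (S : StableSystem A B 𝕂 κB κ γ) : 0 < stateGain κB κ γ := by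
  have := S.kappa_pos
  have := S.kappaB_nonneg
  have := S.inv_pos
  have := S.feedforwardGain_nonneg
  unfold stateGain
  positivity

lemma lipGain_pos (S : StableSystem A B 𝕂 κB κ γ) : 0 < lipGain κB κ γ := by
  have := S.kappa_pos
  have := S.kappaB_nonneg
  have := S.inv_pos
  unfold lipGain
  positivity

/-- Both entries of the maximum defining the feasible set lie under one geometric envelope. -/
lemma specNorm_blk_le (S : StableSystem A B 𝕂 κB κ γ)
    {M : Params H du dx} (hM : M ∈ feasible H du dx κB κ γ) {i : ℕ}
    (hi : i < H) : specNorm (blk M i) ≤ κ ^ 3 * (κB + 2) * (1 - γ) ^ i := by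
  have h1 := S.kappa_pos
  have h2 := S.kappaB_nonneg
  have h3 : 0 ≤ 1 - γ := by linarith [S.lt_one]
  have h4 : 0 ≤ (1 - γ) ^ i := pow_nonneg h3 i
  have h5 : (1 - γ) ^ (i + 1) ≤ (1 - γ) ^ i :=
    pow_le_pow_of_le_one h3 (by linarith [S.pos]) (Nat.le_succ i)
  refine (hM i hi).trans (max_le ?_ ?_)
  · calc κ ^ 3 * κB * (1 - γ) ^ (i + 1) ≤ κ ^ 3 * κB * (1 - γ) ^ i := by gcongr
      _ ≤ κ ^ 3 * (κB + 2) * (1 - γ) ^ i := by gcongr; linarith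
  · calc 2 * κ ^ 3 * (1 - γ) ^ i = κ ^ 3 * 2 * (1 - γ) ^ i := by ring
      _ ≤ κ ^ 3 * (κB + 2) * (1 - γ) ^ i := by gcongr; linarith

/-- The sequence `e` is arbitrary, so that it covers both a full noise history and one padded with
zeros before time `1`. -/
lemma norm_sum_blk_le (S : StableSystem A B 𝕂 κB κ γ)
    {M : Params H du dx} (hM : M ∈ feasible H du dx κB κ γ)
    {e : ℕ → EuclideanSpace ℝ (Fin dx)} (he : ∀ k, ‖e k‖ ≤ W) :
    ‖∑ k ∈ Finset.range H, (blk M k).toEuclideanLin (e k)‖ ≤ W * feedforwardGain κB κ γ := by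
  have h1 := S.kappa_pos
  have h2 := S.kappaB_nonneg
  have h3 : 0 ≤ 1 - γ := by linarith [S.lt_one]
  have hW : 0 ≤ W := (norm_nonneg _).trans (he 0)
  calc _ ≤ ∑ k ∈ Finset.range H, κ ^ 3 * (κB + 2) * (1 - γ) ^ k * W := by
        refine norm_sum_le_of_le _ fun k hk =>
          (norm_toEuclideanLin_le_of_le (S.specNorm_blk_le hM (Finset.mem_range.mp hk)) _).trans ?_
        gcongr
        exact he _
    _ = κ ^ 3 * (κB + 2) * W * ∑ k ∈ Finset.range H, (1 - γ) ^ k := by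
        rw [Finset.mul_sum]
        exact Finset.sum_congr rfl fun k _ => by ring
    _ ≤ κ ^ 3 * (κB + 2) * W * γ⁻¹ := by
        gcongr
        exact sum_one_sub_pow_le S.pos S.lt_one H
    _ = _ := by unfold feedforwardGain; ring

end StableSystem

variable (A B 𝕂) in
/-- The surrogate state at time `t` in terms of a noise sequence indexed by time. -/
def truncState (M : Params H du dx) (e : ℕ → EuclideanSpace ℝ (Fin dx)) (t : ℕ) :
    EuclideanSpace ℝ (Fin dx) :=
  ∑ j ∈ Finset.range (H + 1), ((A - B * 𝕂).toEuclideanLin ^ j)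
    (e (t - 1 - j) + B.toEuclideanLin (feedforward M e (t - 1 - j)))

variable (A B 𝕂) in
/-- The surrogate action at time `t` in terms of a noise sequence indexed by time. -/
def truncAction (M : Params H du dx) (e : ℕ → EuclideanSpace ℝ (Fin dx)) (t : ℕ) :
    EuclideanSpace ℝ (Fin du) :=
  -𝕂.toEuclideanLin (truncState A B 𝕂 M e t) + feedforward M e t

/-- Exchanging the two sums turns the transfer matrices into the response of the `𝕂`-closed loop,
started at zero and driven for `H + 1` steps. The hypothesis on `t` keeps the subtraction `t - 1 - 2
* H` from truncating. -/
lemma surrogateState_eq (M : Params H du dx) (e : ℕ → EuclideanSpace ℝ (Fin dx)) {t : ℕ}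
    (ht : 2 * H + 1 ≤ t) :
    surrogateState A B 𝕂 (fun _ => M) (fun i => e (t - 1 - 2 * H + i)) =
      truncState A B 𝕂 M e t := by
  have h0 : surrogateState A B 𝕂 (fun _ => M) (fun i => e (t - 1 - 2 * H + i)) =
      ∑ i ∈ Finset.range (2 * H + 1),
        (transfer A B 𝕂 (fun _ => M) i).toEuclideanLin (e (t - 1 - i)) := by
    rw [surrogateState, Finset.sum_range]
    refine Finset.sum_congr rfl fun i _ => ?_
    congr 2
    rw [Fin.val_rev]
    omega
  rw [h0]
  simp only [transfer, map_add, LinearMap.add_apply, Finset.sum_add_distrib, truncState]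
  congr 1
  · rw [← Finset.sum_subset (s₁ := Finset.range (H + 1))
      (Finset.range_subset_range.mpr (by omega))]
    · refine Finset.sum_congr rfl fun i hi => ?_
      rw [if_pos (by simpa [Nat.lt_succ_iff] using hi), Matrix.toLpLin_pow]
    · intro i _ hi
      rw [if_neg (by simpa [Nat.lt_succ_iff] using hi)]
      simp
  · simp only [map_sum, LinearMap.sum_apply]
    rw [Finset.sum_comm]
    refine Finset.sum_congr rfl fun j hj => ?_
    have hj' := Finset.mem_range.mp hj
    rw [feedforward, map_sum, map_sum]
    symm
    -- For fixed `j`, block `k` of the feedforward meets the noise of lag `j + 1 + k`; the remaining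
    -- lags contribute zero.
    refine Finset.sum_of_injOn (fun k => j + 1 + k) (fun a _ b _ h => by simpa using h) ?_ ?_ ?_
    · intro k hk
      have := Finset.mem_range.mp (Finset.mem_coe.mp hk)
      simp only [Finset.coe_range, Set.mem_Iio]
      omega
    · intro i _ hi
      rw [if_neg]
      · simp
      · rintro ⟨h1, h2⟩
        exact hi ⟨i - (j + 1), by simp; omega, by dsimp only; omega⟩
    · intro k hk
      have := Finset.mem_range.mp hk
      have e1 : j + 1 + k - j - 1 = k := by omega
      have e2 : t - 1 - (j + 1 + k) = t - 1 - j - 1 - k := by omega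
      rw [if_pos (by omega), toEuclideanLin_mul_apply, toEuclideanLin_mul_apply,
        Matrix.toLpLin_pow, e1, e2]

lemma surrogateAction_eq (M : Params H du dx) (e : ℕ → EuclideanSpace ℝ (Fin dx)) {t : ℕ}
    (ht : 2 * H + 1 ≤ t) :
    surrogateAction A B 𝕂 (fun _ => M) (fun i => e (t - 1 - 2 * H + i)) =
      truncAction A B 𝕂 M e t := by
  rw [surrogateAction, surrogateState_eq M e ht, truncAction, feedforward, Finset.sum_range]
  congr 1
  refine Finset.sum_congr rfl fun i _ => ?_
  congr 2
  rw [Fin.val_rev]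
  dsimp only
  omega

namespace StableSystem

lemma norm_sum_pow_B_le (S : StableSystem A B 𝕂 κB κ γ)
    {n : ℕ} {m : ℕ → EuclideanSpace ℝ (Fin du)} {δ : ℝ} (hδ : 0 ≤ δ)
    (hm : ∀ j < n, ‖m j‖ ≤ δ) :
    ‖∑ j ∈ Finset.range n, ((A - B * 𝕂).toEuclideanLin ^ j) (B.toEuclideanLin (m j))‖ ≤
      κ ^ 2 * γ⁻¹ * κB * δ := by
  have hB := S.kappaB_nonneg
  rw [mul_assoc _ κB]
  refine norm_sum_pow_le (sq_nonneg κ) S.pos S.lt_one (by positivity) S.norm_pow_le fun j hj => ?_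
  refine (norm_toEuclideanLin_le_of_le S.norm_B _).trans ?_
  have := hm j hj
  gcongr

lemma norm_input_le (S : StableSystem A B 𝕂 κB κ γ)
    {z : EuclideanSpace ℝ (Fin dx)} {m : EuclideanSpace ℝ (Fin du)}
    (hz : ‖z‖ ≤ W) (hm : ‖m‖ ≤ W * feedforwardGain κB κ γ) :
    ‖z + B.toEuclideanLin m‖ ≤ W * (1 + κB * feedforwardGain κB κ γ) := by
  refine (norm_add_le _ _).trans ?_
  have h1 := norm_toEuclideanLin_le_of_le S.norm_B m
  have h2 := mul_le_mul_of_nonneg_left hm S.kappaB_nonneg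
  linarith

/-- One radius serves for state and action, as the gradient bounds on the cost require; `κ ≥ 1` lets
the bound on `κ‖x‖` also cover `‖x‖`. -/
lemma state_action_bound (S : StableSystem A B 𝕂 κB κ γ)
    (hW : 0 ≤ W) {x : EuclideanSpace ℝ (Fin dx)}
    {m : EuclideanSpace ℝ (Fin du)}
    (hx : ‖x‖ ≤ κ ^ 2 * γ⁻¹ * (W * (1 + κB * feedforwardGain κB κ γ)))
    (hm : ‖m‖ ≤ W * feedforwardGain κB κ γ) :
    ‖x‖ ≤ W * stateGain κB κ γ ∧ ‖-𝕂.toEuclideanLin x + m‖ ≤ W * stateGain κB κ γ := by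
  have h1 := S.one_le
  have h2 := S.inv_pos
  have h3 := S.feedforwardGain_nonneg
  have h4 := S.kappaB_nonneg
  have hκx : κ * ‖x‖ ≤ κ ^ 3 * γ⁻¹ * (W * (1 + κB * feedforwardGain κB κ γ)) := by
    refine (mul_le_mul_of_nonneg_left hx S.kappa_pos.le).trans (le_of_eq (by ring))
  have hWf : 0 ≤ W * feedforwardGain κB κ γ := by positivity
  have hxx : ‖x‖ ≤ κ * ‖x‖ := le_mul_of_one_le_left (norm_nonneg _) h1
  have e : W * stateGain κB κ γ = κ ^ 3 * γ⁻¹ * (W * (1 + κB * feedforwardGain κB κ γ)) +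
      W * feedforwardGain κB κ γ := by unfold stateGain; ring
  rw [e]
  refine ⟨by linarith, (norm_add_le _ _).trans ?_⟩
  rw [norm_neg]
  have := norm_toEuclideanLin_le_of_le S.norm_gain x
  linarith

lemma trunc_bound (S : StableSystem A B 𝕂 κB κ γ)
    {M : Params H du dx} (hM : M ∈ feasible H du dx κB κ γ)
    {e : ℕ → EuclideanSpace ℝ (Fin dx)} (he : ∀ s, ‖e s‖ ≤ W) (t : ℕ) :
    ‖truncState A B 𝕂 M e t‖ ≤ W * stateGain κB κ γ ∧
      ‖truncAction A B 𝕂 M e t‖ ≤ W * stateGain κB κ γ := by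
  have hW : 0 ≤ W := (norm_nonneg _).trans (he 0)
  have hm : ∀ s, ‖feedforward M e s‖ ≤ W * feedforwardGain κB κ γ := fun s =>
    S.norm_sum_blk_le hM fun k => he _
  have h4 := S.kappaB_nonneg
  have h3 := S.feedforwardGain_nonneg
  refine S.state_action_bound hW ?_ (hm t)
  exact norm_sum_pow_le (sq_nonneg κ) S.pos S.lt_one (by positivity) S.norm_pow_le
    fun j _ => S.norm_input_le (he _) (hm _)

/-- The pure noise terms cancel in the difference, so feasibility of the parameters plays no role.
-/
lemma trunc_lipschitz (S : StableSystem A B 𝕂 κB κ γ)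
    (M N : Params H du dx) {e : ℕ → EuclideanSpace ℝ (Fin dx)}
    (he : ∀ s, ‖e s‖ ≤ W) (t : ℕ) :
    ‖truncState A B 𝕂 M e t - truncState A B 𝕂 N e t‖ +
      ‖truncAction A B 𝕂 M e t - truncAction A B 𝕂 N e t‖ ≤
        lipGain κB κ γ * (W * H * ‖M - N‖) := by
  have hW : 0 ≤ W := (norm_nonneg _).trans (he 0)
  have hδ : 0 ≤ W * H * ‖M - N‖ := by positivity
  have hm : ∀ s, ‖feedforward M e s - feedforward N e s‖ ≤ W * H * ‖M - N‖ := fun s => by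
    rw [← feedforward_sub]
    exact norm_feedforward_le he _ s
  have hx : ‖truncState A B 𝕂 M e t - truncState A B 𝕂 N e t‖ ≤
      κ ^ 2 * γ⁻¹ * κB * (W * H * ‖M - N‖) := by
    have : truncState A B 𝕂 M e t - truncState A B 𝕂 N e t =
        ∑ j ∈ Finset.range (H + 1), ((A - B * 𝕂).toEuclideanLin ^ j) (B.toEuclideanLin
          (feedforward M e (t - 1 - j) - feedforward N e (t - 1 - j))) := by
      rw [truncState, truncState, ← Finset.sum_sub_distrib]
      refine Finset.sum_congr rfl fun j _ => ?_
      rw [← map_sub, map_sub B.toEuclideanLin]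
      congr 1
      abel
    rw [this]
    exact S.norm_sum_pow_B_le hδ fun j _ => hm _
  have hu : ‖truncAction A B 𝕂 M e t - truncAction A B 𝕂 N e t‖ ≤
      κ * ‖truncState A B 𝕂 M e t - truncState A B 𝕂 N e t‖ + W * H * ‖M - N‖ := by
    have : truncAction A B 𝕂 M e t - truncAction A B 𝕂 N e t =
        -𝕂.toEuclideanLin (truncState A B 𝕂 M e t - truncState A B 𝕂 N e t) +
          (feedforward M e t - feedforward N e t) := by
      rw [truncAction, truncAction, map_sub]
      abel
    rw [this]
    refine (norm_add_le _ _).trans (add_le_add ?_ (hm t))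
    rw [norm_neg]
    exact norm_toEuclideanLin_le_of_le S.norm_gain _
  have := mul_le_mul_of_nonneg_left hx S.kappa_pos.le
  unfold lipGain
  linarith

/-- Comparison of a state driven by the inputs `m` with the surrogate state of `M`. -/
lemma trunc_compare (S : StableSystem A B 𝕂 κB κ γ)
    (M : Params H du dx) {e x : ℕ → EuclideanSpace ℝ (Fin dx)}
    {m : ℕ → EuclideanSpace ℝ (Fin du)} {X δ : ℝ} (hδ : 0 ≤ δ)
    (h : ∀ t, 1 ≤ t → x (t + 1) =
      (A - B * 𝕂).toEuclideanLin (x t) + (e t + B.toEuclideanLin (m t)))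
    {t : ℕ} (ht : H + 2 ≤ t) (hX : ‖x (t - H - 1)‖ ≤ X)
    (hm : ∀ s, t - 1 - H ≤ s → s ≤ t → ‖m s - feedforward M e s‖ ≤ δ) :
    ‖x t - truncState A B 𝕂 M e t‖ +
      ‖(-𝕂.toEuclideanLin (x t) + m t) - truncAction A B 𝕂 M e t‖ ≤
        (1 + κ) * (κ ^ 2 * (1 - γ) ^ H * X) + lipGain κB κ γ * δ := by
  have h3 : 0 ≤ 1 - γ := by linarith [S.lt_one]
  have hX0 : 0 ≤ X := (norm_nonneg _).trans hX
  have hx : ‖x t - truncState A B 𝕂 M e t‖ ≤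
      κ ^ 2 * (1 - γ) ^ H * X + κ ^ 2 * γ⁻¹ * κB * δ := by
    -- Starting at `t - H - 1`, the unrolled inputs are exactly the `H + 1` terms of `truncState`;
    -- only the propagated old state is left over.
    have hun := linear_recursion_unroll h (s := t - H - 1) (by omega) (H + 1)
    rw [show t - H - 1 + (H + 1) = t by omega] at hun
    have : x t - truncState A B 𝕂 M e t =
        ((A - B * 𝕂).toEuclideanLin ^ (H + 1)) (x (t - H - 1)) +
        ∑ j ∈ Finset.range (H + 1), ((A - B * 𝕂).toEuclideanLin ^ j) (B.toEuclideanLin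
          (m (t - 1 - j) - feedforward M e (t - 1 - j))) := by
      rw [hun, truncState, add_sub_assoc, ← Finset.sum_sub_distrib]
      congr 1
      refine Finset.sum_congr rfl fun j _ => ?_
      rw [← map_sub, map_sub B.toEuclideanLin]
      congr 1
      abel
    rw [this]
    refine (norm_add_le _ _).trans (add_le_add ?_ ?_)
    · refine (S.norm_pow_le _ _).trans ?_
      -- The exponent is weakened to `H`, the power controlled by the choice of horizon.
      have : (1 - γ) ^ (H + 1) ≤ (1 - γ) ^ H :=
        pow_le_pow_of_le_one h3 (by linarith [S.pos]) (Nat.le_succ H)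
      gcongr
    · refine S.norm_sum_pow_B_le hδ fun j hj => hm _ (by omega) (by omega)
  have hu : ‖(-𝕂.toEuclideanLin (x t) + m t) - truncAction A B 𝕂 M e t‖ ≤
      κ * ‖x t - truncState A B 𝕂 M e t‖ + δ := by
    have : (-𝕂.toEuclideanLin (x t) + m t) - truncAction A B 𝕂 M e t =
        -𝕂.toEuclideanLin (x t - truncState A B 𝕂 M e t) + (m t - feedforward M e t) := by
      rw [truncAction, map_sub]
      abel
    rw [this]
    refine (norm_add_le _ _).trans (add_le_add ?_ (hm t (by omega) le_rfl))
    rw [norm_neg]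
    exact norm_toEuclideanLin_le_of_le S.norm_gain _
  have := mul_le_mul_of_nonneg_left hx S.kappa_pos.le
  unfold lipGain
  linarith

end StableSystem

end Dynamics

/-! ### Consequences of the cost assumptions -/

section Cost

variable {dx du : ℕ} {α G : ℝ} {c : EuclideanSpace ℝ (Fin dx) → EuclideanSpace ℝ (Fin du) → ℝ}

lemma norm_gradient_eq {F : Type*} [NormedAddCommGroup F] [InnerProductSpace ℝ F]
    [CompleteSpace F] (f : F → ℝ) (x : F) : ‖gradient f x‖ = ‖fderiv ℝ f x‖ := by
  simp [gradient]

namespace CostClass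

lemma continuous (h : CostClass α G c) : Continuous (fun z : _ × _ => c z.1 z.2) :=
  h.diff.continuous

lemma G_nonneg (h : CostClass α G c) : 0 ≤ G := by
  have := (norm_nonneg _).trans (h.grad_x 1 0 0 (by simp) (by simp))
  linarith

/-- Mean value inequality on the ball of radius `D`, changing first the state and then the action.
-/
lemma abs_sub_le (h : CostClass α G c) {D : ℝ} {x x' : EuclideanSpace ℝ (Fin dx)}
    {u u' : EuclideanSpace ℝ (Fin du)} (hx : ‖x‖ ≤ D) (hx' : ‖x'‖ ≤ D) (hu : ‖u‖ ≤ D)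
    (hu' : ‖u'‖ ≤ D) : |c x u - c x' u'| ≤ G * D * (‖x - x'‖ + ‖u - u'‖) := by
  have d1 : Differentiable ℝ (fun y => c y u) :=
    h.diff.comp (differentiable_id.prodMk (differentiable_const u))
  have d2 : Differentiable ℝ (fun y => c x' y) :=
    h.diff.comp ((differentiable_const x').prodMk differentiable_id)
  have b1 : ‖c x u - c x' u‖ ≤ G * D * ‖x - x'‖ := by
    refine Convex.norm_image_sub_le_of_norm_fderiv_le (𝕜 := ℝ) (f := fun y => c y u)
      (s := Metric.closedBall 0 D) (fun y _ => d1 y) (fun y hy => ?_) (convex_closedBall 0 D)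
      (by simpa using hx') (by simpa using hx)
    rw [← norm_gradient_eq]
    exact h.grad_x D y u (by simpa using hy) hu
  have b2 : ‖c x' u - c x' u'‖ ≤ G * D * ‖u - u'‖ := by
    refine Convex.norm_image_sub_le_of_norm_fderiv_le (𝕜 := ℝ) (f := fun y => c x' y)
      (s := Metric.closedBall 0 D) (fun y _ => d2 y) (fun y hy => ?_) (convex_closedBall 0 D)
      (by simpa using hu') (by simpa using hu)
    rw [← norm_gradient_eq]
    exact h.grad_u D x' y hx' (by simpa using hy)
  have := norm_sub_le_norm_sub_add_norm_sub (c x u) (c x' u) (c x' u')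
  rw [← Real.norm_eq_abs]
  linarith

lemma abs_sub_zero_le (h : CostClass α G c) {D : ℝ} {x : EuclideanSpace ℝ (Fin dx)}
    {u : EuclideanSpace ℝ (Fin du)} (hx : ‖x‖ ≤ D) (hu : ‖u‖ ≤ D) :
    |c x u - c 0 0| ≤ 2 * G * D ^ 2 := by
  have hD : 0 ≤ D := (norm_nonneg x).trans hx
  have hG := h.G_nonneg
  refine (h.abs_sub_le (D := D) hx (by simpa using hD) hu (by simpa using hD)).trans ?_
  rw [sub_zero, sub_zero]
  calc G * D * (‖x‖ + ‖u‖) ≤ G * D * (D + D) := by gcongr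
    _ = _ := by ring

lemma strong_convexity (h : CostClass α G c) (x x' : EuclideanSpace ℝ (Fin dx))
    (u u' : EuclideanSpace ℝ (Fin du)) {a b : ℝ} (ha : 0 ≤ a) (hb : 0 ≤ b) (hab : a + b = 1) :
    c (a • x + b • x') (a • u + b • u') ≤ a * c x u + b * c x' u' -
      a * b * (α / 2 * (‖x - x'‖ ^ 2 + ‖u - u'‖ ^ 2)) := by
  have := h.strong.2 (Set.mem_univ (WithLp.toLp 2 (x, u))) (Set.mem_univ (WithLp.toLp 2 (x', u')))
    ha hb hab
  simpa [WithLp.prod_norm_sq_eq_of_L2] using this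

/-- Strong convexity at the midpoint of `0` and a unit state vector `e` gives `α/8 ≤ (c(e) - c(0))/2
+ (c(0) - c(e/2))`, and the gradient bounds make the right side at most `G/2 + G/4`. -/
lemma alpha_le (h : CostClass α G c) (hdx : 0 < dx) : α ≤ 6 * G := by
  have hG := h.G_nonneg
  set e : EuclideanSpace ℝ (Fin dx) := EuclideanSpace.single ⟨0, hdx⟩ 1
  have he : ‖e‖ = 1 := by simp [e]
  have h1 := h.strong_convexity 0 e 0 0 (a := 1 / 2) (b := 1 / 2) (by norm_num) (by norm_num)
    (by norm_num)
  have hn : ‖(1 / 2 : ℝ) • e‖ = 1 / 2 := by rw [norm_smul, he]; norm_num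
  have h2 := h.abs_sub_le (D := 1 / 2) (x := (1 / 2 : ℝ) • e) (x' := 0) (u := 0) (u' := 0)
    hn.le (by simp) (by simp) (by simp)
  have h3 := h.abs_sub_le (D := 1) (x := e) (x' := 0) (u := 0) (u' := 0) he.le (by simp)
    (by simp) (by simp)
  simp only [smul_zero, zero_add, sub_zero, zero_sub, norm_neg, he, norm_zero, hn, add_zero]
    at h1 h2 h3
  have h2' := abs_le.mp h2
  have h3' := abs_le.mp h3
  linarith [h2'.1, h3'.2]

end CostClass

end Cost

/-! ### True trajectories against their surrogates -/

section Trajectories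

variable {H dx du : ℕ} {A : Matrix (Fin dx) (Fin dx) ℝ} {B : Matrix (Fin dx) (Fin du) ℝ}
  {𝕂 K : Matrix (Fin du) (Fin dx) ℝ} {κB κ γ W : ℝ}

lemma states_succ (π : ℕ → EuclideanSpace ℝ (Fin dx) → EuclideanSpace ℝ (Fin du))
    (w : ℕ → EuclideanSpace ℝ (Fin dx)) {t : ℕ} (ht : 1 ≤ t) :
    states A B π w (t + 1) = A.toEuclideanLin (states A B π w t) +
      B.toEuclideanLin (π t (states A B π w t)) + w t := by
  obtain ⟨s, rfl⟩ := Nat.exists_eq_add_of_le' ht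
  rfl

/-- The feedforward part of a disturbance-action policy with time-varying parameters. -/
def dapInput (M : ℕ → Params H du dx) (w : ℕ → EuclideanSpace ℝ (Fin dx)) (t : ℕ) :
    EuclideanSpace ℝ (Fin du) :=
  ∑ i ∈ Finset.Icc 1 H, if i < t then (blk (M t) (i - 1)).toEuclideanLin (w (t - i)) else 0

/-- Moves the cutoff before time `1` from the summands to the noise, so that bounds for arbitrary
sequences apply. -/
lemma dapInput_eq_sum_range (M : ℕ → Params H du dx) (w : ℕ → EuclideanSpace ℝ (Fin dx)) (t : ℕ) :
    dapInput M w t = ∑ k ∈ Finset.range H,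
      (blk (M t) k).toEuclideanLin (if k + 1 < t then w (t - 1 - k) else 0) := by
  rw [dapInput, show Finset.Icc 1 H = Finset.Ico 1 (H + 1) by ext; simp,
    Finset.sum_Ico_eq_sum_range, Nat.add_sub_cancel]
  refine Finset.sum_congr rfl fun i _ => ?_
  rw [add_comm 1 i, Nat.add_sub_cancel, show t - (i + 1) = t - 1 - i by omega]
  split_ifs <;> simp

lemma dapInput_eq_feedforward (M : ℕ → Params H du dx) (w : ℕ → EuclideanSpace ℝ (Fin dx))
    {t : ℕ} (ht : H < t) : dapInput M w t = feedforward (M t) w t := by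
  rw [dapInput_eq_sum_range, feedforward]
  refine Finset.sum_congr rfl fun k hk => ?_
  rw [if_pos (by have := Finset.mem_range.mp hk; omega)]

lemma states_dap_succ (M : ℕ → Params H du dx) (w : ℕ → EuclideanSpace ℝ (Fin dx)) {t : ℕ}
    (ht : 1 ≤ t) :
    states A B (dapPolicy 𝕂 M w) w (t + 1) =
      (A - B * 𝕂).toEuclideanLin (states A B (dapPolicy 𝕂 M w) w t) +
        (w t + B.toEuclideanLin (dapInput M w t)) := by
  rw [states_succ _ _ ht]
  conv_lhs => rw [dapPolicy, ← dapInput]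
  rw [map_sub, LinearMap.sub_apply, toEuclideanLin_mul_apply, map_add, map_neg]
  abel

lemma states_linear_succ (w : ℕ → EuclideanSpace ℝ (Fin dx)) {t : ℕ} (ht : 1 ≤ t) :
    states A B (linearPolicy K) w (t + 1) =
      (A - B * K).toEuclideanLin (states A B (linearPolicy K) w t) + w t := by
  rw [states_succ _ _ ht]
  conv_lhs => rw [linearPolicy]
  rw [map_sub, LinearMap.sub_apply, toEuclideanLin_mul_apply, map_neg]
  abel

/-- The disturbance-action parameters that imitate the linear policy `K`. -/
def imitation (A : Matrix (Fin dx) (Fin dx) ℝ) (B : Matrix (Fin dx) (Fin du) ℝ)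
    (𝕂 K : Matrix (Fin du) (Fin dx) ℝ) (H : ℕ) : Params H du dx :=
  WithLp.toLp 2 fun p => ((𝕂 - K) * (A - B * K) ^ (p.1 : ℕ)) p.2.1 p.2.2

lemma blk_imitation {i : ℕ} (hi : i < H) :
    blk (imitation A B 𝕂 K H) i = (𝕂 - K) * (A - B * K) ^ i := by
  ext
  simp [blk, hi, imitation]

namespace StableSystem

lemma dap_bound (S : StableSystem A B 𝕂 κB κ γ)
    {M : ℕ → Params H du dx} {w : ℕ → EuclideanSpace ℝ (Fin dx)}
    (hw : ∀ s, ‖w s‖ ≤ W) {T : ℕ}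
    (hM : ∀ t, 1 ≤ t → t ≤ T → M t ∈ feasible H du dx κB κ γ) {t : ℕ} (ht : 1 ≤ t)
    (htT : t ≤ T) :
    ‖states A B (dapPolicy 𝕂 M w) w t‖ ≤ W * stateGain κB κ γ ∧
      ‖dapPolicy 𝕂 M w t (states A B (dapPolicy 𝕂 M w) w t)‖ ≤ W * stateGain κB κ γ := by
  have hW : 0 ≤ W := (norm_nonneg _).trans (hw 0)
  have h3 := S.feedforwardGain_nonneg
  have h4 := S.kappaB_nonneg
  have hm : ∀ s, 1 ≤ s → s ≤ T → ‖dapInput M w s‖ ≤ W * feedforwardGain κB κ γ := by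
    intro s hs hsT
    rw [dapInput_eq_sum_range]
    refine S.norm_sum_blk_le (e := fun k => if k + 1 < s then w (s - 1 - k) else 0)
      (hM s hs hsT) fun k => ?_
    split_ifs
    · exact hw _
    · simpa using hW
  refine S.state_action_bound hW ?_ (hm t ht htT)
  exact norm_linear_recursion_le (sq_nonneg κ) S.pos S.lt_one (by positivity) S.norm_pow_le
    (fun s hs => states_dap_succ M w hs) rfl ht
    fun s hs hst => S.norm_input_le (hw s) (hm s hs (by omega))

lemma linear_bound (S : StableSystem A B 𝕂 κB κ γ)
    (hK : DiagStronglyStable A B κ γ K) {w : ℕ → EuclideanSpace ℝ (Fin dx)}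
    (hw : ∀ s, ‖w s‖ ≤ W) {t : ℕ} (ht : 1 ≤ t) :
    ‖states A B (linearPolicy K) w t‖ ≤ W * stateGain κB κ γ ∧
      ‖linearPolicy K t (states A B (linearPolicy K) w t)‖ ≤ W * stateGain κB κ γ := by
  have hW : 0 ≤ W := (norm_nonneg _).trans (hw 0)
  have h3 := S.feedforwardGain_nonneg
  have h4 := S.kappaB_nonneg
  have h5 := S.inv_pos
  have S' : StableSystem A B K κB κ γ := ⟨S.one_le, S.pos, S.lt_one, S.norm_B, hK⟩
  have hx : ‖states A B (linearPolicy K) w t‖ ≤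
      κ ^ 2 * γ⁻¹ * (W * (1 + κB * feedforwardGain κB κ γ)) := by
    refine (norm_linear_recursion_le (sq_nonneg κ) S.pos S.lt_one hW S'.norm_pow_le
      (fun s hs => states_linear_succ w hs) rfl ht fun s _ _ => hw s).trans ?_
    gcongr
    exact le_mul_of_one_le_right hW (by linarith [mul_nonneg h4 h3])
  have := S'.state_action_bound (m := 0) hW hx (by simp; positivity)
  simpa [linearPolicy] using this

/-- `‖𝕂 - K‖ ≤ 2κ` and `‖(A - BK)^i‖ ≤ κ²(1-γ)^i`; this is the purpose of the second entry of the
maximum in the feasible set. -/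
lemma imitation_feasible (S : StableSystem A B 𝕂 κB κ γ) (hK : DiagStronglyStable A B κ γ K) :
    imitation A B 𝕂 K H ∈ feasible H du dx κB κ γ := by
  have hκ := S.kappa_pos
  have S' : StableSystem A B K κB κ γ := ⟨S.one_le, S.pos, S.lt_one, S.norm_B, hK⟩
  have h3 : 0 ≤ 1 - γ := by linarith [S.lt_one]
  intro i hi
  refine le_max_of_le_right ?_
  rw [blk_imitation hi]
  refine specNorm_le (by positivity) fun x => ?_
  rw [toEuclideanLin_mul_apply, Matrix.toLpLin_pow]
  have h2 : specNorm (𝕂 - K) ≤ 2 * κ := by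
    linarith [specNorm_sub_le 𝕂 K, S.norm_gain, S'.norm_gain]
  calc _ ≤ 2 * κ * _ := norm_toEuclideanLin_le_of_le h2 _
    _ ≤ 2 * κ * (κ ^ 2 * (1 - γ) ^ i * ‖x‖) := by gcongr; exact S'.norm_pow_le i x
    _ = _ := by ring

/-- The trajectory of `K` is a `𝕂`-closed loop with input `(𝕂 - K) x_s`. Unrolling `x_s` for `H`
steps under `A - BK` turns this input into the imitating feedforward plus `(𝕂 - K)(A - BK)^H
x_{s-H}`, which is exponentially small. Since `s ≥ t - 1 - H`, the bound on `t` ensures `s - H ≥ 1`.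
-/
lemma linear_compare (S : StableSystem A B 𝕂 κB κ γ)
    (hK : DiagStronglyStable A B κ γ K) {w : ℕ → EuclideanSpace ℝ (Fin dx)}
    (hw : ∀ s, ‖w s‖ ≤ W) {t : ℕ} (ht : 2 * H + 2 ≤ t) :
    ‖states A B (linearPolicy K) w t - truncState A B 𝕂 (imitation A B 𝕂 K H) w t‖ +
      ‖linearPolicy K t (states A B (linearPolicy K) w t) -
        truncAction A B 𝕂 (imitation A B 𝕂 K H) w t‖ ≤
      (1 + κ + 2 * κ * lipGain κB κ γ) *
        (κ ^ 2 * (1 - γ) ^ H * (W * stateGain κB κ γ)) := by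
  have hκ := S.kappa_pos
  have hW : 0 ≤ W := (norm_nonneg _).trans (hw 0)
  have hg := S.stateGain_pos
  have S' : StableSystem A B K κB κ γ := ⟨S.one_le, S.pos, S.lt_one, S.norm_B, hK⟩
  have h3 : 0 ≤ 1 - γ := by linarith [S.lt_one]
  have hKK : specNorm (𝕂 - K) ≤ 2 * κ := by
    linarith [specNorm_sub_le 𝕂 K, S.norm_gain, S'.norm_gain]
  set x := states A B (linearPolicy K) w with hx
  have hrec : ∀ t, 1 ≤ t → x (t + 1) = (A - B * 𝕂).toEuclideanLin (x t) +
      (w t + B.toEuclideanLin ((𝕂 - K).toEuclideanLin (x t))) := by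
    intro t ht
    rw [hx, states_linear_succ w ht]
    simp only [map_sub, LinearMap.sub_apply, toEuclideanLin_mul_apply]
    abel
  have hm : ∀ s, t - 1 - H ≤ s → s ≤ t → ‖(𝕂 - K).toEuclideanLin (x s) -
      feedforward (imitation A B 𝕂 K H) w s‖ ≤
        2 * κ * (κ ^ 2 * (1 - γ) ^ H * (W * stateGain κB κ γ)) := by
    intro s hs _
    have hun := linear_recursion_unroll (x := x) (fun t ht => states_linear_succ (K := K) w ht)
      (s := s - H) (by omega) H
    rw [show s - H + H = s by omega] at hun
    have : (𝕂 - K).toEuclideanLin (x s) - feedforward (imitation A B 𝕂 K H) w s =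
        (𝕂 - K).toEuclideanLin (((A - B * K).toEuclideanLin ^ H) (x (s - H))) := by
      rw [sub_eq_iff_eq_add, hun, map_add, map_sum, feedforward]
      congr 1
      refine Finset.sum_congr rfl fun k hk => ?_
      rw [blk_imitation (Finset.mem_range.mp hk), toEuclideanLin_mul_apply, Matrix.toLpLin_pow]
    rw [this]
    refine (norm_toEuclideanLin_le_of_le hKK _).trans ?_
    gcongr
    refine (S'.norm_pow_le H _).trans ?_
    gcongr
    exact (S.linear_bound hK hw (by omega)).1
  have := S.trunc_compare (imitation A B 𝕂 K H) (by positivity) hrec (t := t) (by omega)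
    (S.linear_bound hK hw (by omega)).1 hm
  have e : linearPolicy K t (x t) = -𝕂.toEuclideanLin (x t) + (𝕂 - K).toEuclideanLin (x t) := by
    simp only [linearPolicy, map_sub, LinearMap.sub_apply]
    abel
  rw [e]
  refine this.trans (le_of_eq (by ring))

/-- The inputs in the window use `M s` whereas the surrogate uses `M t` throughout; `δ` measures
this drift. The bound on `t` puts the whole window after time `H`, where no noise is cut off. -/
lemma dap_compare (S : StableSystem A B 𝕂 κB κ γ)
    {M : ℕ → Params H du dx} {w : ℕ → EuclideanSpace ℝ (Fin dx)}
    (hw : ∀ s, ‖w s‖ ≤ W) {T : ℕ}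
    (hM : ∀ t, 1 ≤ t → t ≤ T → M t ∈ feasible H du dx κB κ γ) {t : ℕ} (ht : 2 * H + 2 ≤ t)
    (htT : t ≤ T) {δ : ℝ} (hδ : ∀ s, t - 1 - H ≤ s → s ≤ t → ‖M s - M t‖ ≤ δ) :
    ‖states A B (dapPolicy 𝕂 M w) w t - truncState A B 𝕂 (M t) w t‖ +
      ‖dapPolicy 𝕂 M w t (states A B (dapPolicy 𝕂 M w) w t) - truncAction A B 𝕂 (M t) w t‖ ≤
      (1 + κ) * (κ ^ 2 * (1 - γ) ^ H * (W * stateGain κB κ γ)) +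
        lipGain κB κ γ * (W * H * δ) := by
  have hW : 0 ≤ W := (norm_nonneg _).trans (hw 0)
  have hδ0 : 0 ≤ δ := (norm_nonneg _).trans (hδ t (by omega) le_rfl)
  refine S.trunc_compare (M t) (m := dapInput M w) (by positivity)
    (fun s hs => states_dap_succ M w hs) (by omega)
    (S.dap_bound hw hM (by omega) (by omega)).1 fun s hs hst => ?_
  rw [dapInput_eq_feedforward _ _ (by omega), ← feedforward_sub]
  refine (norm_feedforward_le hw _ s).trans ?_
  gcongr
  exact hδ s hs hst

end StableSystem

end Trajectories

/-! ### Projected online gradient descent -/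

section GradientDescent

variable {F : Type*} [NormedAddCommGroup F] [InnerProductSpace ℝ F]

open Filter Topology in
-- Divide the convexity inequality on the segment from `x` to `y` by `s` and let `s` tend to `0`
-- from the right.
lemma sub_le_inner_gradient_of_strongly_convex [CompleteSpace F] {f : F → ℝ} {x y : F} {μ : ℝ}
    (hf : DifferentiableAt ℝ f x)
    (h : ∀ s : ℝ, 0 < s → s < 1 → f ((1 - s) • x + s • y) ≤
      (1 - s) * f x + s * f y - (1 - s) * s * (μ / 2 * ‖x - y‖ ^ 2)) :
    f x - f y ≤ inner ℝ (gradient f x) (x - y) - μ / 2 * ‖x - y‖ ^ 2 := by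
  have hg : HasDerivAt (fun s : ℝ => f (x + s • (y - x))) (inner ℝ (gradient f x) (y - x)) 0 := by
    have h1 : HasDerivAt (fun s : ℝ => x + s • (y - x)) (y - x) 0 := by
      simpa using ((hasDerivAt_id (0 : ℝ)).smul_const (y - x)).const_add x
    have h2 : HasFDerivAt f (InnerProductSpace.toDual ℝ F (gradient f x))
        (x + (0 : ℝ) • (y - x)) := by
      simpa using hf.hasGradientAt.hasFDerivAt
    exact h2.comp_hasDerivAt (0 : ℝ) h1
  have ht : Tendsto (fun s : ℝ => s⁻¹ * (f (x + s • (y - x)) - f x)) (𝓝[>] 0)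
      (𝓝 (inner ℝ (gradient f x) (y - x))) := by
    have := hg.tendsto_slope_zero_right
    simpa using this
  have hr : Tendsto (fun s : ℝ => f y - f x - (1 - s) * (μ / 2 * ‖x - y‖ ^ 2)) (𝓝[>] 0)
      (𝓝 (f y - f x - (1 - 0) * (μ / 2 * ‖x - y‖ ^ 2))) := by
    apply Tendsto.mono_left _ nhdsWithin_le_nhds
    apply Continuous.tendsto
    fun_prop
  have key : inner ℝ (gradient f x) (y - x) ≤ f y - f x - (1 - 0) * (μ / 2 * ‖x - y‖ ^ 2) := by
    refine le_of_tendsto_of_tendsto ht hr ?_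
    filter_upwards [Ioo_mem_nhdsGT (zero_lt_one' ℝ)] with s hs
    have h1 := h s hs.1 hs.2
    have e : (1 - s) • x + s • y = x + s • (y - x) := by module
    rw [e] at h1
    rw [inv_mul_le_iff₀ hs.1]
    linarith
  have e : inner ℝ (gradient f x) (x - y) = -inner ℝ (gradient f x) (y - x) := by
    rw [← inner_neg_right, neg_sub]
  rw [e]
  linarith

/-- The nearest point of a convex set makes an obtuse angle with every other point of the set. -/
lemma norm_sub_sq_le_of_projection {C : Set F} (hC : Convex ℝ C) {u v z : F} (hv : v ∈ C)
    (hz : z ∈ C) (h : dist u v = Metric.infDist u C) : ‖v - z‖ ^ 2 ≤ ‖u - z‖ ^ 2 := by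
  rw [Metric.infDist_eq_iInf, dist_eq_norm] at h
  simp only [dist_eq_norm] at h
  have h1 := (norm_eq_iInf_iff_real_inner_le_zero hC hv).mp h z hz
  have e : u - z = (u - v) - (z - v) := by abel
  rw [e, norm_sub_sq_real (u - v), norm_sub_rev v z]
  nlinarith [sq_nonneg ‖u - v‖]

/-- Triangle inequality through the unprojected point: as `x` lies in `C`, projecting moves that
point by at most `η‖g‖`. No convexity is needed. -/
lemma norm_step_le {C : Set F} {x g y : F} {η : ℝ} (hη : 0 ≤ η) (hx : x ∈ C)
    (h : dist (x - η • g) y = Metric.infDist (x - η • g) C) : ‖y - x‖ ≤ 2 * (η * ‖g‖) := by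
  have h1 : dist (x - η • g) y ≤ η * ‖g‖ := by
    rw [h]
    refine (Metric.infDist_le_dist_of_mem hx).trans ?_
    simp [norm_smul, abs_of_nonneg hη]
  have h2 : dist x (x - η • g) = η * ‖g‖ := by
    simp [norm_smul, abs_of_nonneg hη]
  have := dist_triangle x (x - η • g) y
  rw [← dist_eq_norm, dist_comm]
  linarith

lemma sum_inv_le_one_add_log (T : ℕ) :
    ∑ t ∈ Finset.Icc 1 T, ((t : ℝ))⁻¹ ≤ 1 + Real.log T := by
  have h := harmonic_le_one_add_log T
  rw [harmonic_eq_sum_Icc] at h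
  push_cast at h
  exact h

/-- Regret of projected online gradient descent with step sizes `θ / (β t)` when the losses have
strong convexity modulus at least `β / θ`. -/
lemma gradient_descent_regret {C : Set F} (hC : Convex ℝ C) {f : ℕ → F → ℝ} {M g : ℕ → F}
    {θ β ℓ : ℝ} (hθ : 0 < θ) (hβ : 0 < β) {T : ℕ} (hT : 1 ≤ T) {N : F} (hN : N ∈ C)
    (hM : ∀ t, 1 ≤ t → t < T → M (t + 1) ∈ C ∧
      dist (M t - (θ / (β * t)) • g t) (M (t + 1)) =
        Metric.infDist (M t - (θ / (β * t)) • g t) C)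
    (hg : ∀ t, 1 ≤ t → t ≤ T → ‖g t‖ ≤ ℓ)
    (hf : ∀ t, 1 ≤ t → t ≤ T → f t (M t) - f t N ≤
      inner ℝ (g t) (M t - N) - β / θ / 2 * ‖M t - N‖ ^ 2) :
    ∑ t ∈ Finset.Icc 1 T, (f t (M t) - f t N) ≤ θ / (2 * β) * ℓ ^ 2 * (1 + Real.log T) := by
  have hgt : ∀ t, 1 ≤ t → t ≤ T → ‖g t‖ ^ 2 ≤ ℓ ^ 2 := fun t h1 h2 =>
    pow_le_pow_left₀ (norm_nonneg _) (hg t h1 h2) 2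
  -- The induction keeps the negative distance term; with steps `θ/(βt)` its coefficient grows by
  -- `β/θ/2` per round, which the strong convexity term pays for.
  have key : ∀ n, n < T → ∑ t ∈ Finset.Icc 1 n, (f t (M t) - f t N) ≤
      θ / (2 * β) * ℓ ^ 2 * ∑ t ∈ Finset.Icc 1 n, ((t : ℝ))⁻¹ -
        β / θ / 2 * n * ‖M (n + 1) - N‖ ^ 2 := by
    intro n hn
    induction n with
    | zero => simp
    | succ n ih =>
      have ih := ih (by omega)
      rw [Finset.sum_Icc_succ_top (by omega), Finset.sum_Icc_succ_top (by omega)]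
      obtain ⟨h1, h2⟩ := hM (n + 1) (by omega) hn
      have h3 := norm_sub_sq_le_of_projection hC h1 hN h2
      have h4 := hf (n + 1) (by omega) hn.le
      have h5 := hgt (n + 1) (by omega) hn.le
      have hn0 : (0 : ℝ) < ((n + 1 : ℕ) : ℝ) := by positivity
      set r : ℝ := ((n + 1 : ℕ) : ℝ) with hr
      have hrn : (n : ℝ) = r - 1 := by rw [hr]; push_cast; ring
      have e : M (n + 1) - (θ / (β * r)) • g (n + 1) - N =
          (M (n + 1) - N) - (θ / (β * r)) • g (n + 1) := by abel
      rw [e, norm_sub_sq_real (M (n + 1) - N), norm_smul, inner_smul_right,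
        Real.norm_of_nonneg (by positivity), real_inner_comm] at h3
      -- The factor is `1/(2η)` for the step size `η = θ/(βr)`.
      have h6 := mul_le_mul_of_nonneg_left h3 (show 0 ≤ β / θ / 2 * r by positivity)
      have e2 : β / θ / 2 * r * (‖M (n + 1) - N‖ ^ 2 - 2 * (θ / (β * r) *
          inner ℝ (g (n + 1)) (M (n + 1) - N)) + (θ / (β * r) * ‖g (n + 1)‖) ^ 2) =
          β / θ / 2 * r * ‖M (n + 1) - N‖ ^ 2 - inner ℝ (g (n + 1)) (M (n + 1) - N) +
            θ / (2 * β) * r⁻¹ * ‖g (n + 1)‖ ^ 2 := by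
        field_simp
      rw [e2] at h6
      have h7 := mul_le_mul_of_nonneg_left h5 (show 0 ≤ θ / (2 * β) * r⁻¹ by positivity)
      rw [hrn] at ih
      linarith
  -- No update follows round `T`, so in the last round nonnegativity of a squared norm replaces the
  -- projection inequality.
  obtain ⟨n, rfl⟩ := Nat.exists_eq_add_of_le' hT
  have ih := key n (by omega)
  have h4 := hf (n + 1) (by omega) le_rfl
  have h5 := hgt (n + 1) (by omega) le_rfl
  have hlog := mul_le_mul_of_nonneg_left (sum_inv_le_one_add_log (n + 1))
    (show 0 ≤ θ / (2 * β) * ℓ ^ 2 by positivity)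
  refine le_trans ?_ hlog
  rw [Finset.sum_Icc_succ_top (by omega), Finset.sum_Icc_succ_top (by omega)]
  have hn0 : (0 : ℝ) < ((n + 1 : ℕ) : ℝ) := by positivity
  set r : ℝ := ((n + 1 : ℕ) : ℝ) with hr
  have hrn : (n : ℝ) = r - 1 := by rw [hr]; push_cast; ring
  have h6 : 0 ≤ β / θ / 2 * r * ‖(M (n + 1) - N) - (θ / (β * r)) • g (n + 1)‖ ^ 2 := by
    positivity
  rw [norm_sub_sq_real, norm_smul, inner_smul_right, Real.norm_of_nonneg (by positivity),
    real_inner_comm] at h6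
  have e2 : β / θ / 2 * r * (‖M (n + 1) - N‖ ^ 2 - 2 * (θ / (β * r) *
      inner ℝ (g (n + 1)) (M (n + 1) - N)) + (θ / (β * r) * ‖g (n + 1)‖) ^ 2) =
      β / θ / 2 * r * ‖M (n + 1) - N‖ ^ 2 - inner ℝ (g (n + 1)) (M (n + 1) - N) +
        θ / (2 * β) * r⁻¹ * ‖g (n + 1)‖ ^ 2 := by
    field_simp
  rw [e2] at h6
  have h7 := mul_le_mul_of_nonneg_left h5 (show 0 ≤ θ / (2 * β) * r⁻¹ by positivity)
  rw [hrn] at ih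
  linarith

/-- Movement of the iterates over a window `[s, t]` that stays away from time `0`. -/
lemma norm_iterate_sub_le {C : Set F} {M g : ℕ → F} {θ β ℓ : ℝ} (hθ : 0 < θ) (hβ : 0 < β)
    {T : ℕ} (hM : ∀ t, 1 ≤ t → t ≤ T → M t ∈ C)
    (hstep : ∀ t, 1 ≤ t → t < T → dist (M t - (θ / (β * t)) • g t) (M (t + 1)) =
      Metric.infDist (M t - (θ / (β * t)) • g t) C)
    (hg : ∀ t, 1 ≤ t → t ≤ T → ‖g t‖ ≤ ℓ) {s t : ℕ} (hs : 1 ≤ s) (hst : s ≤ t) (htT : t ≤ T)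
    (hts : t ≤ 2 * s) :
    ‖M s - M t‖ ≤ (t - s : ℕ) * (4 * (θ / β) * ℓ * (t : ℝ)⁻¹) := by
  have hℓ : 0 ≤ ℓ := (norm_nonneg _).trans (hg s hs (by omega))
  have ht0 : (0 : ℝ) < t := by exact_mod_cast (show 0 < t by omega)
  have hd := dist_le_Ico_sum_of_dist_le (f := M) hst
    (d := fun _ => 4 * (θ / β) * ℓ * (t : ℝ)⁻¹) (fun {k} hk hk' => ?_)
  · rw [dist_eq_norm, Finset.sum_const, Nat.card_Ico, nsmul_eq_mul] at hd
    exact hd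
  · have hk0 : (0 : ℝ) < k := by exact_mod_cast (show 0 < k by omega)
    have h1 := norm_step_le (by positivity) (hM k (by omega) (by omega))
      (hstep k (by omega) (by omega))
    rw [dist_comm, dist_eq_norm]
    refine h1.trans ?_
    have h2 := hg k (by omega) (by omega)
    -- Here `t ≤ 2s ≤ 2k`: all step sizes in the window are comparable to the last.
    have h3 : (k : ℝ)⁻¹ ≤ 2 * (t : ℝ)⁻¹ := by
      rw [← div_eq_mul_inv, inv_le_comm₀ hk0 (by positivity), inv_div, div_le_iff₀ (by norm_num)]
      exact_mod_cast (show t ≤ k * 2 by omega)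
    calc 2 * (θ / (β * k) * ‖g k‖) = 2 * (θ / β) * ‖g k‖ * (k : ℝ)⁻¹ := by field_simp
      _ ≤ 2 * (θ / β) * ℓ * (2 * (t : ℝ)⁻¹) := by gcongr
      _ = _ := by ring

end GradientDescent

/-! ### Second moments of the noise -/

section Noise

variable {dx : ℕ} {𝒟 : Measure (EuclideanSpace ℝ (Fin dx))} {σ W : ℝ}

namespace NoiseLaw

lemma W_nonneg (h : NoiseLaw 𝒟 σ W) : 0 ≤ W := by
  have := h.prob
  obtain ⟨x, hx⟩ := h.bounded.exists
  exact (norm_nonneg x).trans hx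

lemma integrable_of_continuous (h : NoiseLaw 𝒟 σ W) {f : EuclideanSpace ℝ (Fin dx) → ℝ}
    (hf : Continuous f) : Integrable f 𝒟 := by
  have := h.prob
  obtain ⟨C, hC⟩ := (isCompact_closedBall
    (0 : EuclideanSpace ℝ (Fin dx)) W).exists_bound_of_continuousOn hf.continuousOn
  refine Integrable.of_bound hf.aestronglyMeasurable C ?_
  filter_upwards [h.bounded] with x hx
  exact hC x (by simpa using hx)

lemma integral_inner (h : NoiseLaw 𝒟 σ W) (r : EuclideanSpace ℝ (Fin dx)) :
    ∫ z, inner ℝ r z ∂𝒟 = 0 := by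
  have := h.prob
  have hi : Integrable (fun z : EuclideanSpace ℝ (Fin dx) => z) 𝒟 :=
    Integrable.of_bound continuous_id.aestronglyMeasurable W h.bounded
  rw [_root_.integral_inner hi, h.mean_zero, inner_zero_right]

lemma le_integral_inner_sq (h : NoiseLaw 𝒟 σ W) (r : EuclideanSpace ℝ (Fin dx)) :
    σ ^ 2 * ‖r‖ ^ 2 ≤ ∫ z, (inner ℝ r z) ^ 2 ∂𝒟 := by
  have hi : ∀ i j : Fin dx, Integrable (fun z : EuclideanSpace ℝ (Fin dx) =>
      r i * r j * (z i * z j)) 𝒟 := fun i j => h.integrable_of_continuous (by fun_prop)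
  have e : ∫ z, (inner ℝ r z) ^ 2 ∂𝒟 = ∑ i, ∑ j, r i * r j * ∫ z, z i * z j ∂𝒟 := by
    have : ∀ z : EuclideanSpace ℝ (Fin dx), (inner ℝ r z) ^ 2 =
        ∑ i, ∑ j, r i * r j * (z i * z j) := by
      intro z
      rw [PiLp.inner_apply, sq, Finset.sum_mul_sum]
      refine Finset.sum_congr rfl fun i _ => Finset.sum_congr rfl fun j _ => ?_
      simp
      ring
    simp_rw [this]
    rw [integral_finsetSum _ fun i _ => integrable_finsetSum _ fun j _ => hi i j]
    refine Finset.sum_congr rfl fun i _ => ?_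
    rw [integral_finsetSum _ fun j _ => hi i j]
    exact Finset.sum_congr rfl fun j _ => integral_const_mul _ _
  have hp := h.cov.dotProduct_mulVec_nonneg r.ofLp
  rw [Matrix.sub_mulVec, dotProduct_sub, Matrix.smul_mulVec, Matrix.one_mulVec] at hp
  rw [e, EuclideanSpace.norm_sq_eq]
  have e1 : star r.ofLp ⬝ᵥ (Matrix.of fun i j : Fin dx => ∫ x, x i * x j ∂𝒟) *ᵥ r.ofLp =
      ∑ i, ∑ j, r i * r j * ∫ z, z i * z j ∂𝒟 := by
    simp only [dotProduct, Matrix.mulVec, Matrix.of_apply, Finset.mul_sum]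
    refine Finset.sum_congr rfl fun i _ => Finset.sum_congr rfl fun j _ => ?_
    simp
    ring
  have e2 : star r.ofLp ⬝ᵥ (σ ^ 2 • r.ofLp) = σ ^ 2 * ∑ i, ‖r i‖ ^ 2 := by
    simp only [dotProduct, Finset.mul_sum]
    refine Finset.sum_congr rfl fun i _ => ?_
    simp
    ring
  rw [e1, e2] at hp
  linarith

/-- The second moment in a unit direction lies between `σ²` and `W²`. -/
lemma sigma_sq_le (h : NoiseLaw 𝒟 σ W) (hdx : 0 < dx) : σ ^ 2 ≤ W ^ 2 := by
  have := h.prob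
  set e : EuclideanSpace ℝ (Fin dx) := EuclideanSpace.single ⟨0, hdx⟩ 1
  have he : ‖e‖ = 1 := by simp [e]
  have h1 := h.le_integral_inner_sq e
  rw [he, one_pow, mul_one] at h1
  refine h1.trans ?_
  calc _ ≤ ∫ _z, W ^ 2 ∂𝒟 := by
        refine integral_mono_ae (h.integrable_of_continuous (by fun_prop)) (integrable_const _) ?_
        filter_upwards [h.bounded] with z hz
        have := abs_real_inner_le_norm e z
        rw [he, one_mul] at this
        exact sq_le_sq' (by linarith [(abs_le.mp this).1]) (by linarith [(abs_le.mp this).2])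
    _ = W ^ 2 := by simp

variable {n : ℕ}

lemma ae_pi_bounded (h : NoiseLaw 𝒟 σ W) :
    ∀ᵐ w ∂(Measure.pi fun _ : Fin n => 𝒟), ∀ i, ‖w i‖ ≤ W := by
  have := h.prob
  rw [ae_all_iff]
  intro i
  exact (measurePreserving_eval (fun _ : Fin n => 𝒟) i).quasiMeasurePreserving.ae h.bounded

/-- The second moment dominates the variance; `ρ` being injective, the summands are independent and
variances add; zero mean turns each variance into a second moment of the noise. -/
lemma le_integral_sum_inner_sq (h : NoiseLaw 𝒟 σ W) {m : ℕ} {ρ : Fin m → Fin n}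
    (hρ : Function.Injective ρ) (r : Fin m → EuclideanSpace ℝ (Fin dx)) :
    σ ^ 2 * ∑ k, ‖r k‖ ^ 2 ≤
      ∫ w, (∑ k, inner ℝ (r k) (w (ρ k))) ^ 2 ∂(Measure.pi fun _ : Fin n => 𝒟) := by
  have := h.prob
  set ν := Measure.pi fun _ : Fin n => 𝒟
  let Y : Fin m → (Fin n → EuclideanSpace ℝ (Fin dx)) → ℝ := fun k w => inner ℝ (r k) (w (ρ k))
  have hYc : ∀ k, Continuous (Y k) := fun k => by fun_prop
  have hmp : ∀ i, MeasurePreserving (Function.eval i) ν 𝒟 := fun i =>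
    measurePreserving_eval (fun _ : Fin n => 𝒟) i
  have hInt : ∀ i (g : EuclideanSpace ℝ (Fin dx) → ℝ), Continuous g →
      ∫ w, g (w i) ∂ν = ∫ z, g z ∂𝒟 := fun i g hg => by
    have := integral_map (hmp i).aemeasurable (f := g) hg.aestronglyMeasurable
    rw [(hmp i).map_eq] at this
    exact this.symm
  have hmem : ∀ k, MemLp (Y k) 2 ν := fun k => by
    refine MemLp.of_bound (hYc k).aestronglyMeasurable (‖r k‖ * W) ?_
    filter_upwards [h.ae_pi_bounded] with w hw
    exact (norm_inner_le_norm _ _).trans (mul_le_mul_of_nonneg_left (hw _) (norm_nonneg _))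
  have hind : iIndepFun (fun (i : Fin n) (w : Fin n → EuclideanSpace ℝ (Fin dx)) => w i) ν :=
    iIndepFun_pi (X := fun _ x => x) fun i => aemeasurable_id
  have hpair : ((Finset.univ : Finset (Fin m)) : Set (Fin m)).Pairwise
      fun i j => IndepFun (Y i) (Y j) ν := by
    intro i _ j _ hij
    exact (hind.indepFun (hρ.ne hij)).comp (φ := fun z => inner ℝ (r i) z)
      (ψ := fun z => inner ℝ (r j) z) (by fun_prop) (by fun_prop)
  have hvar : ∀ k, σ ^ 2 * ‖r k‖ ^ 2 ≤ variance (Y k) ν := by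
    intro k
    rw [variance_eq_sub (hmem k)]
    have e1 : ∫ w, Y k w ∂ν = 0 :=
      (hInt _ (fun z => inner ℝ (r k) z) (by fun_prop)).trans (h.integral_inner (r k))
    have e2 : ∫ w, (Y k ^ 2) w ∂ν = ∫ z, (inner ℝ (r k) z) ^ 2 ∂𝒟 :=
      hInt _ (fun z => (inner ℝ (r k) z) ^ 2) (by fun_prop)
    rw [e1, e2]
    simpa using h.le_integral_inner_sq (r k)
  calc _ = ∑ k, σ ^ 2 * ‖r k‖ ^ 2 := Finset.mul_sum _ _ _
    _ ≤ ∑ k, variance (Y k) ν := Finset.sum_le_sum fun k _ => hvar k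
    _ = variance (∑ k, Y k) ν := (IndepFun.variance_sum (fun k _ => hmem k) hpair).symm
    _ ≤ ∫ w, ((∑ k, Y k) ^ 2) w ∂ν := by
        refine variance_le_expectation_sq ?_
        exact Finset.aestronglyMeasurable_sum _ fun k _ => (hYc k).aestronglyMeasurable
    _ = _ := by simp [Y]

end NoiseLaw

end Noise

/-! ### Continuity in parameters and noise -/

section Continuity

variable {H dx du : ℕ} {A : Matrix (Fin dx) (Fin dx) ℝ} {B : Matrix (Fin dx) (Fin du) ℝ}
  {𝕂 K : Matrix (Fin du) (Fin dx) ℝ}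

lemma continuous_toEuclideanLin {m n : ℕ} (A : Matrix (Fin m) (Fin n) ℝ) :
    Continuous A.toEuclideanLin :=
  LinearMap.continuous_of_finiteDimensional _

lemma continuous_blk (k : ℕ) : Continuous (fun M : Params H du dx => blk M k) := by
  unfold blk
  split_ifs
  · exact continuous_matrix fun a b => by simp only [Matrix.of_apply]; fun_prop
  · exact continuous_const

lemma continuous_blk_apply {X : Type*} [TopologicalSpace X] {f : X → Params H du dx}
    {g : X → EuclideanSpace ℝ (Fin dx)} (hf : Continuous f) (hg : Continuous g) (k : ℕ) :
    Continuous (fun x => (blk (f x) k).toEuclideanLin (g x)) := by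
  have h : Continuous (fun x => blk (f x) k *ᵥ (g x).ofLp) :=
    ((continuous_blk k).comp hf).matrix_mulVec ((PiLp.continuous_ofLp 2 _).comp hg)
  simp only [Matrix.toLpLin_apply]
  exact (PiLp.continuous_toLp 2 _).comp h

lemma continuous_feedforward (s : ℕ) :
    Continuous (fun p : Params H du dx × (ℕ → EuclideanSpace ℝ (Fin dx)) =>
      feedforward p.1 p.2 s) := by
  unfold feedforward
  refine continuous_finsetSum _ fun k _ => ?_
  exact continuous_blk_apply continuous_fst (by fun_prop) k

lemma continuous_truncState (t : ℕ) :
    Continuous (fun p : Params H du dx × (ℕ → EuclideanSpace ℝ (Fin dx)) =>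
      truncState A B 𝕂 p.1 p.2 t) := by
  unfold truncState
  refine continuous_finsetSum _ fun j _ => ?_
  refine (LinearMap.continuous_of_finiteDimensional _).comp (Continuous.add ?_ ?_)
  · exact (continuous_apply (t - 1 - j)).comp continuous_snd
  · exact (continuous_toEuclideanLin B).comp (continuous_feedforward _)

lemma continuous_truncAction (t : ℕ) :
    Continuous (fun p : Params H du dx × (ℕ → EuclideanSpace ℝ (Fin dx)) =>
      truncAction A B 𝕂 p.1 p.2 t) := by
  unfold truncAction
  exact ((continuous_toEuclideanLin 𝕂).comp (continuous_truncState t)).neg.add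
    (continuous_feedforward t)

lemma continuous_dapInput (M : ℕ → Params H du dx) (t : ℕ) :
    Continuous (fun e : ℕ → EuclideanSpace ℝ (Fin dx) => dapInput M e t) := by
  unfold dapInput
  refine continuous_finsetSum _ fun i _ => ?_
  split_ifs
  · exact (continuous_toEuclideanLin _).comp (continuous_apply _)
  · exact continuous_const

lemma continuous_states_dap (M : ℕ → Params H du dx) {t : ℕ} (ht : 1 ≤ t) :
    Continuous (fun e : ℕ → EuclideanSpace ℝ (Fin dx) => states A B (dapPolicy 𝕂 M e) e t) := by
  induction t, ht using Nat.le_induction with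
  | base => exact continuous_const
  | succ t ht ih =>
    simp only [states_dap_succ M _ ht]
    exact ((continuous_toEuclideanLin _).comp ih).add
      ((continuous_apply t).add ((continuous_toEuclideanLin B).comp (continuous_dapInput M t)))

lemma continuous_action_dap (M : ℕ → Params H du dx) {t : ℕ} (ht : 1 ≤ t) :
    Continuous (fun e : ℕ → EuclideanSpace ℝ (Fin dx) =>
      dapPolicy 𝕂 M e t (states A B (dapPolicy 𝕂 M e) e t)) :=
  ((continuous_toEuclideanLin 𝕂).comp (continuous_states_dap M ht)).neg.add
    (continuous_dapInput M t)

lemma continuous_states_linear {t : ℕ} (ht : 1 ≤ t) :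
    Continuous (fun e : ℕ → EuclideanSpace ℝ (Fin dx) => states A B (linearPolicy K) e t) := by
  induction t, ht using Nat.le_induction with
  | base => exact continuous_const
  | succ t ht ih =>
    simp only [states_linear_succ _ ht]
    exact ((continuous_toEuclideanLin _).comp ih).add (continuous_apply t)

lemma continuous_action_linear {t : ℕ} (ht : 1 ≤ t) :
    Continuous (fun e : ℕ → EuclideanSpace ℝ (Fin dx) =>
      linearPolicy K t (states A B (linearPolicy K) e t)) :=
  ((continuous_toEuclideanLin K).comp (continuous_states_linear ht)).neg

end Continuity

/-! ### Surrogate costs: gradient bound and strong convexity -/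

section Surrogate

variable {H dx du : ℕ} {A : Matrix (Fin dx) (Fin dx) ℝ} {B : Matrix (Fin dx) (Fin du) ℝ}
  {𝕂 K : Matrix (Fin du) (Fin dx) ℝ} {κB κ γ W σ α G : ℝ}
  {𝒟 : Measure (EuclideanSpace ℝ (Fin dx))}
  {c : EuclideanSpace ℝ (Fin dx) → EuclideanSpace ℝ (Fin du) → ℝ}

/-- Bounded noise sequences form a product of closed balls, compact by Tychonoff, on which a
continuous function is bounded. -/
lemma integrable_comp_noise {X : Type*} [MeasurableSpace X] {μ : Measure X} [IsFiniteMeasure μ]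
    {e : X → ℕ → EuclideanSpace ℝ (Fin dx)} (he : Measurable e)
    (hb : ∀ᵐ x ∂μ, ∀ s, ‖e x s‖ ≤ W) {g : (ℕ → EuclideanSpace ℝ (Fin dx)) → ℝ}
    (hg : Continuous g) : Integrable (fun x => g (e x)) μ := by
  have hc : IsCompact (Set.univ.pi fun _ : ℕ =>
      Metric.closedBall (0 : EuclideanSpace ℝ (Fin dx)) W) :=
    isCompact_univ_pi fun _ => isCompact_closedBall _ _
  obtain ⟨C, hC⟩ := hc.exists_bound_of_continuousOn hg.continuousOn
  refine Integrable.of_bound (hg.measurable.comp he).aestronglyMeasurable C ?_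
  filter_upwards [hb] with x hx
  exact hC _ fun s _ => by simpa using hx s

/-- A finite noise vector, continued by `0`. -/
def extendZero {n : ℕ} (w : Fin n → EuclideanSpace ℝ (Fin dx)) (i : ℕ) :
    EuclideanSpace ℝ (Fin dx) :=
  if h : i < n then w ⟨i, h⟩ else 0

lemma extendZero_shift (w : Fin (2 * H + 1) → EuclideanSpace ℝ (Fin dx)) :
    (fun i : Fin (2 * H + 1) => extendZero w (2 * H + 1 - 1 - 2 * H + i)) = w := by
  ext1 i
  have e : 2 * H + 1 - 1 - 2 * H + (i : ℕ) = i := by omega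
  rw [e, extendZero, dif_pos i.isLt]

lemma continuous_extendZero {n : ℕ} :
    Continuous (extendZero : (Fin n → EuclideanSpace ℝ (Fin dx)) → _) := by
  refine continuous_pi fun i => ?_
  unfold extendZero
  split_ifs
  · exact continuous_apply _
  · exact continuous_const

lemma NoiseLaw.ae_extendZero (h : NoiseLaw 𝒟 σ W) {n : ℕ} :
    ∀ᵐ w ∂(Measure.pi fun _ : Fin n => 𝒟), ∀ s, ‖extendZero w s‖ ≤ W := by
  filter_upwards [h.ae_pi_bounded] with w hw s
  unfold extendZero
  split_ifs
  · exact hw _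
  · simpa using h.W_nonneg

variable (A B 𝕂) in
/-- The cost of surrogate state and action at time `t` along a noise sequence. -/
def truncCost (c : EuclideanSpace ℝ (Fin dx) → EuclideanSpace ℝ (Fin du) → ℝ)
    (M : Params H du dx) (e : ℕ → EuclideanSpace ℝ (Fin dx)) (t : ℕ) : ℝ :=
  c (truncState A B 𝕂 M e t) (truncAction A B 𝕂 M e t)

lemma CostClass.continuous_truncCost (hc : CostClass α G c) (t : ℕ) :
    Continuous (fun p : Params H du dx × (ℕ → EuclideanSpace ℝ (Fin dx)) =>
      truncCost A B 𝕂 c p.1 p.2 t) :=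
  hc.continuous.comp ((continuous_truncState t).prodMk (continuous_truncAction t))

lemma CostClass.continuous_truncCost_noise (hc : CostClass α G c) (M : Params H du dx) (t : ℕ) :
    Continuous (fun e : ℕ → EuclideanSpace ℝ (Fin dx) => truncCost A B 𝕂 c M e t) :=
  (hc.continuous_truncCost t).comp (continuous_const.prodMk continuous_id)

lemma surrogateCost_eq (M : Params H du dx) :
    surrogateCost A B 𝕂 𝒟 c M = ∫ w, truncCost A B 𝕂 c M (extendZero w) (2 * H + 1)
      ∂(Measure.pi fun _ : Fin (2 * H + 1) => 𝒟) := by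
  refine integral_congr_ae (Filter.Eventually.of_forall fun w => ?_)
  dsimp only
  conv_lhs => rw [← extendZero_shift w]
  rw [surrogateState_eq M (extendZero w) le_rfl, surrogateAction_eq M (extendZero w) le_rfl,
    truncCost]

/-- The `2H + 1` noise vectors preceding time `t` are independent with law `𝒟`, and the surrogate at
time `t` depends on nothing else. -/
lemma surrogateCost_eq_expectation {Ω : Type*} [MeasurableSpace Ω] {P : Measure Ω}
    [IsProbabilityMeasure P] {w : ℕ → Ω → EuclideanSpace ℝ (Fin dx)}
    (hw : ∀ t, Measurable (w t)) (hlaw : ∀ t, P.map (w t) = 𝒟) (hind : iIndepFun w P)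
    (hc : CostClass α G c) (M : Params H du dx) {t : ℕ} (ht : 2 * H + 1 ≤ t) :
    surrogateCost A B 𝕂 𝒟 c M = ∫ ω, truncCost A B 𝕂 c M (fun s => w s ω) t ∂P := by
  have hinj : Function.Injective (fun i : Fin (2 * H + 1) => t - 1 - 2 * H + (i : ℕ)) :=
    fun i j h => Fin.ext (by simpa using h)
  have hmap := (iIndepFun_iff_map_fun_eq_pi_map (fun i => (hw _).aemeasurable)).mp
    (hind.precomp hinj)
  simp only [hlaw] at hmap
  rw [surrogateCost_eq, ← hmap, integral_map]
  · refine integral_congr_ae (Filter.Eventually.of_forall fun ω => ?_)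
    have h1 := surrogateState_eq (A := A) (B := B) (𝕂 := 𝕂) M (fun s => w s ω) ht
    have h2 := surrogateAction_eq (A := A) (B := B) (𝕂 := 𝕂) M (fun s => w s ω) ht
    set v : Fin (2 * H + 1) → EuclideanSpace ℝ (Fin dx) :=
      fun i => w (t - 1 - 2 * H + i) ω
    dsimp only [truncCost]
    rw [← surrogateState_eq M (extendZero v) le_rfl, ← surrogateAction_eq M (extendZero v) le_rfl,
      extendZero_shift, h1, h2]
  · exact (measurable_pi_lambda _ fun i => hw _).aemeasurable
  · exact ((hc.continuous_truncCost_noise M _).comp continuous_extendZero).aestronglyMeasurable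

lemma differentiable_feedforward (e : ℕ → EuclideanSpace ℝ (Fin dx)) (s : ℕ) :
    Differentiable ℝ (fun M : Params H du dx => feedforward M e s) :=
  (IsLinearMap.mk' (fun M : Params H du dx => feedforward M e s)
    ⟨fun M N => feedforward_add M N e s,
      fun a M => feedforward_smul a M e s⟩).toContinuousLinearMap.differentiable

lemma differentiable_truncState (e : ℕ → EuclideanSpace ℝ (Fin dx)) (t : ℕ) :
    Differentiable ℝ (fun M : Params H du dx => truncState A B 𝕂 M e t) := by
  unfold truncState
  refine Differentiable.fun_sum fun j _ => ?_
  exact (LinearMap.toContinuousLinearMap _).differentiable.comp ((differentiable_const _).add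
    (B.toEuclideanLin.toContinuousLinearMap.differentiable.comp (differentiable_feedforward e _)))

lemma differentiable_truncAction (e : ℕ → EuclideanSpace ℝ (Fin dx)) (t : ℕ) :
    Differentiable ℝ (fun M : Params H du dx => truncAction A B 𝕂 M e t) := by
  unfold truncAction
  exact (𝕂.toEuclideanLin.toContinuousLinearMap.differentiable.comp
    (differentiable_truncState e t)).neg.add (differentiable_feedforward e t)

lemma CostClass.differentiable_truncCost (hc : CostClass α G c)
    (e : ℕ → EuclideanSpace ℝ (Fin dx)) (t : ℕ) :
    Differentiable ℝ (fun M : Params H du dx => truncCost A B 𝕂 c M e t) :=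
  hc.diff.comp ((differentiable_truncState e t).prodMk (differentiable_truncAction e t))

/-- A Lipschitz constant of the surrogate costs near the feasible set. -/
def surrogateLip (κB κ γ G W : ℝ) (H : ℕ) : ℝ :=
  2 * G * stateGain κB κ γ * lipGain κB κ γ * W ^ 2 * H

lemma StableSystem.surrogateLip_nonneg (S : StableSystem A B 𝕂 κB κ γ) (hG : 0 ≤ G) :
    0 ≤ surrogateLip κB κ γ G W H := by
  have := S.stateGain_pos
  have := S.lipGain_pos
  unfold surrogateLip
  positivity

/-- Differentiation under the integral needs a neighbourhood independent of the noise. On this ball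
the bounds on state and action at most double, whence the factor `2` in `surrogateLip`; `H + 1`
keeps the radius positive when `H = 0`. -/
lemma StableSystem.truncCost_lipschitzOn (S : StableSystem A B 𝕂 κB κ γ) (hc : CostClass α G c)
    {M : Params H du dx} (hM : M ∈ feasible H du dx κB κ γ)
    {e : ℕ → EuclideanSpace ℝ (Fin dx)} (he : ∀ s, ‖e s‖ ≤ W) (t : ℕ) :
    LipschitzOnWith (Real.nnabs (surrogateLip κB κ γ G W H))
      (fun N => truncCost A B 𝕂 c N e t)
      (Metric.ball M (stateGain κB κ γ / (lipGain κB κ γ * (H + 1)))) := by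
  have hW : 0 ≤ W := (norm_nonneg _).trans (he 0)
  have hg := S.stateGain_pos
  have hl := S.lipGain_pos
  have hG := hc.G_nonneg
  have hb : ∀ N ∈ Metric.ball M (stateGain κB κ γ / (lipGain κB κ γ * (H + 1))),
      ‖truncState A B 𝕂 N e t‖ ≤ 2 * (W * stateGain κB κ γ) ∧
      ‖truncAction A B 𝕂 N e t‖ ≤ 2 * (W * stateGain κB κ γ) := by
    intro N hN
    have h1 := S.trunc_lipschitz N M he t
    obtain ⟨h2, h3⟩ := S.trunc_bound hM he t
    have h4 : lipGain κB κ γ * (W * H * ‖N - M‖) ≤ W * stateGain κB κ γ := by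
      have hN' : ‖N - M‖ ≤ stateGain κB κ γ / (lipGain κB κ γ * (H + 1)) := by
        rw [← dist_eq_norm]
        exact (Metric.mem_ball.mp hN).le
      rw [le_div_iff₀ (by positivity)] at hN'
      have : lipGain κB κ γ * (W * H * ‖N - M‖) ≤ W * (‖N - M‖ * (lipGain κB κ γ * (H + 1))) := by
        have : 0 ≤ W * ‖N - M‖ * lipGain κB κ γ := by positivity
        nlinarith
      exact this.trans (mul_le_mul_of_nonneg_left hN' hW)
    have h5 := norm_le_norm_add_norm_sub' (truncState A B 𝕂 N e t) (truncState A B 𝕂 M e t)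
    have h6 := norm_le_norm_add_norm_sub' (truncAction A B 𝕂 N e t) (truncAction A B 𝕂 M e t)
    have h7 := norm_nonneg (truncState A B 𝕂 N e t - truncState A B 𝕂 M e t)
    have h8 := norm_nonneg (truncAction A B 𝕂 N e t - truncAction A B 𝕂 M e t)
    constructor <;> linarith
  refine LipschitzOnWith.of_dist_le_mul fun N hN N' hN' => ?_
  rw [Real.coe_nnabs, abs_of_nonneg (S.surrogateLip_nonneg hG), dist_eq_norm, dist_eq_norm,
    Real.norm_eq_abs]
  have h1 := hc.abs_sub_le (hb N hN).1 (hb N' hN').1 (hb N hN).2 (hb N' hN').2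
  refine h1.trans ((mul_le_mul_of_nonneg_left (S.trunc_lipschitz N N' he t)
    (by positivity)).trans (le_of_eq ?_))
  unfold surrogateLip
  ring

lemma measurable_fderiv_param {X E : Type*} [TopologicalSpace X] [MeasurableSpace X]
    [OpensMeasurableSpace X] [NormedAddCommGroup E] [NormedSpace ℝ E] [LocallyCompactSpace E]
    [MeasurableSpace E] [OpensMeasurableSpace E] {f : X → E → ℝ}
    (hf : Continuous (Function.uncurry f)) (x₀ : E) :
    Measurable (fun w => fderiv ℝ (f w) x₀) :=
  (measurable_fderiv_with_param ℝ hf).comp (measurable_id.prodMk measurable_const)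

lemma StableSystem.surrogateCost_hasFDerivAt (S : StableSystem A B 𝕂 κB κ γ)
    (hc : CostClass α G c) (hD : NoiseLaw 𝒟 σ W) {M : Params H du dx}
    (hM : M ∈ feasible H du dx κB κ γ) :
    ∃ f' : Params H du dx →L[ℝ] ℝ, HasFDerivAt (surrogateCost A B 𝕂 𝒟 c) f' M ∧
      ‖f'‖ ≤ surrogateLip κB κ γ G W H := by
  have := hD.prob
  have hl := S.lipGain_pos
  have hg := S.stateGain_pos
  have hG := hc.G_nonneg
  set ν := Measure.pi fun _ : Fin (2 * H + 1) => 𝒟 with hν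
  have hs : Metric.ball M (stateGain κB κ γ / (lipGain κB κ γ * (H + 1))) ∈ nhds M :=
    Metric.ball_mem_nhds _ (by positivity)
  let F : Params H du dx → (Fin (2 * H + 1) → EuclideanSpace ℝ (Fin dx)) → ℝ :=
    fun N w => truncCost A B 𝕂 c N (extendZero w) (2 * H + 1)
  have hF : ∀ N, Continuous (F N) := fun N =>
    (hc.continuous_truncCost_noise N _).comp continuous_extendZero
  have hlip : ∀ᵐ w ∂ν, LipschitzOnWith (Real.nnabs (surrogateLip κB κ γ G W H))
      (fun N => F N w) (Metric.ball M (stateGain κB κ γ / (lipGain κB κ γ * (H + 1)))) := by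
    filter_upwards [hD.ae_extendZero] with w hw
    exact S.truncCost_lipschitzOn hc hM hw _
  have hd : ∀ w, HasFDerivAt (fun N => F N w) (fderiv ℝ (fun N => F N w) M) M := fun w =>
    (hc.differentiable_truncCost (extendZero w) _ M).hasFDerivAt
  have hmeas : Measurable (fun w => fderiv ℝ (fun N => F N w) M) := by
    have hcont : Continuous (Function.uncurry fun (w : Fin (2 * H + 1) → _) N => F N w) :=
      (hc.continuous_truncCost (2 * H + 1)).comp
        (continuous_snd.prodMk (continuous_extendZero.comp continuous_fst))
    exact measurable_fderiv_param hcont M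
  have key := hasFDerivAt_integral_of_dominated_loc_of_lip (𝕜 := ℝ) (μ := ν) (F := F) (x₀ := M)
    (bound := fun _ => surrogateLip κB κ γ G W H) hs
    (Filter.Eventually.of_forall fun N => (hF N).aestronglyMeasurable)
    (integrable_comp_noise continuous_extendZero.measurable hD.ae_extendZero
      (hc.continuous_truncCost_noise M _)) hmeas.aestronglyMeasurable hlip (integrable_const _)
    (Filter.Eventually.of_forall hd)
  refine ⟨∫ w, fderiv ℝ (fun N => F N w) M ∂ν, ?_, ?_⟩
  · have e : surrogateCost A B 𝕂 𝒟 c = fun N => ∫ w, F N w ∂ν := funext fun N => surrogateCost_eq N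
    rw [e]
    exact key.2
  · refine (norm_integral_le_of_norm_le_const (C := surrogateLip κB κ γ G W H) ?_).trans
      (by simp)
    filter_upwards [hlip] with w hw
    have := (hd w).le_of_lipschitzOn hs hw
    rwa [Real.coe_nnabs, abs_of_nonneg (S.surrogateLip_nonneg hG)] at this

/-- Each coordinate of the feedforward is a sum of inner products of rows of the blocks with
distinct, hence independent, noise vectors. Summing over coordinates restores the Frobenius norm. -/
lemma NoiseLaw.le_integral_feedforward_sq (h : NoiseLaw 𝒟 σ W) (N : Params H du dx) :
    σ ^ 2 * ‖N‖ ^ 2 ≤ ∫ w, ‖feedforward N (extendZero w) (2 * H + 1)‖ ^ 2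
      ∂(Measure.pi fun _ : Fin (2 * H + 1) => 𝒟) := by
  have := h.prob
  set ν := Measure.pi fun _ : Fin (2 * H + 1) => 𝒟
  let ρ : Fin H → Fin (2 * H + 1) := fun k => ⟨2 * H - k, by omega⟩
  have hρ : Function.Injective ρ := fun i j hij => by
    simp only [ρ, Fin.mk.injEq] at hij
    omega
  let row : Fin du → Fin H → EuclideanSpace ℝ (Fin dx) := fun a k =>
    WithLp.toLp 2 fun b => N (k, a, b)
  have hcoord : ∀ w a, feedforward N (extendZero w) (2 * H + 1) a =
      ∑ k, inner ℝ (row a k) (w (ρ k)) := by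
    intro w a
    rw [feedforward, Finset.sum_range, WithLp.ofLp_sum, Finset.sum_apply]
    refine Finset.sum_congr rfl fun k _ => ?_
    have e : extendZero w (2 * H + 1 - 1 - k) = w (ρ k) := by
      simp only [extendZero, ρ]
      rw [dif_pos (by omega)]
      rfl
    rw [e, PiLp.inner_apply]
    simp [Matrix.mulVec, dotProduct, blk, row, mul_comm]
  have hInt : ∀ a, Integrable (fun w => (∑ k, inner ℝ (row a k) (w (ρ k))) ^ 2) ν := by
    intro a
    have hcf : Continuous (fun e : ℕ → EuclideanSpace ℝ (Fin dx) =>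
        (feedforward N e (2 * H + 1) a) ^ 2) := by
      have := (continuous_feedforward (H := H) (du := du) (2 * H + 1)).comp
        (continuous_const (y := N) |>.prodMk (continuous_id (X := ℕ → EuclideanSpace ℝ (Fin dx))))
      exact ((EuclideanSpace.proj (𝕜 := ℝ) a).continuous.comp this).pow 2
    have := integrable_comp_noise continuous_extendZero.measurable
      (h.ae_extendZero (n := 2 * H + 1)) hcf
    simpa only [hcoord] using this
  have e1 : ∫ w, ‖feedforward N (extendZero w) (2 * H + 1)‖ ^ 2 ∂ν =
      ∑ a, ∫ w, (∑ k, inner ℝ (row a k) (w (ρ k))) ^ 2 ∂ν := by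
    rw [← integral_finsetSum _ fun a _ => hInt a]
    refine integral_congr_ae (Filter.Eventually.of_forall fun w => ?_)
    simp only [EuclideanSpace.norm_sq_eq, hcoord, Real.norm_eq_abs, sq_abs]
  have e2 : ‖N‖ ^ 2 = ∑ a, ∑ k, ‖row a k‖ ^ 2 := by
    rw [Finset.sum_comm, EuclideanSpace.norm_sq_eq, Fintype.sum_prod_type]
    refine Finset.sum_congr rfl fun k _ => ?_
    rw [Fintype.sum_prod_type]
    simp [row, EuclideanSpace.norm_sq_eq]
  rw [e1, e2, Finset.mul_sum]
  exact Finset.sum_le_sum fun a _ => h.le_integral_sum_inner_sq hρ (row a)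

lemma truncState_affine (M N : Params H du dx) (e : ℕ → EuclideanSpace ℝ (Fin dx)) (t : ℕ)
    {a b : ℝ} (hab : a + b = 1) :
    truncState A B 𝕂 (a • M + b • N) e t =
      a • truncState A B 𝕂 M e t + b • truncState A B 𝕂 N e t := by
  simp only [truncState, Finset.smul_sum, ← Finset.sum_add_distrib, ← map_smul, ← map_add]
  refine Finset.sum_congr rfl fun j _ => congrArg _ ?_
  rw [feedforward_add, feedforward_smul, feedforward_smul, map_add, map_smul, map_smul]
  -- The constant part of the affine map is split according to the weights.
  have : e (t - 1 - j) = (a + b) • e (t - 1 - j) := by rw [hab, one_smul]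
  conv_lhs => rw [this]
  module

lemma truncAction_affine (M N : Params H du dx) (e : ℕ → EuclideanSpace ℝ (Fin dx)) (t : ℕ)
    {a b : ℝ} (hab : a + b = 1) :
    truncAction A B 𝕂 (a • M + b • N) e t =
      a • truncAction A B 𝕂 M e t + b • truncAction A B 𝕂 N e t := by
  simp only [truncAction, truncState_affine M N e t hab, feedforward_add, feedforward_smul,
    map_add, map_smul]
  module

/-- Adding `𝕂` times the state to the action recovers the feedforward, so parameters can be read off
from state and action. Then `(‖v‖ + κ‖y‖)² ≤ 2‖v‖² + 2κ²‖y‖²`, and `κ ≥ 1`. -/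
lemma StableSystem.norm_feedforward_sub_sq_le (S : StableSystem A B 𝕂 κB κ γ)
    (M N : Params H du dx) (e : ℕ → EuclideanSpace ℝ (Fin dx)) (t : ℕ) :
    ‖feedforward (M - N) e t‖ ^ 2 ≤
      2 * κ ^ 2 * (‖truncState A B 𝕂 M e t - truncState A B 𝕂 N e t‖ ^ 2 +
        ‖truncAction A B 𝕂 M e t - truncAction A B 𝕂 N e t‖ ^ 2) := by
  have e1 : feedforward (M - N) e t = (truncAction A B 𝕂 M e t - truncAction A B 𝕂 N e t) +
      𝕂.toEuclideanLin (truncState A B 𝕂 M e t - truncState A B 𝕂 N e t) := by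
    rw [feedforward_sub, truncAction, truncAction, map_sub]
    abel
  rw [e1]
  set y := truncState A B 𝕂 M e t - truncState A B 𝕂 N e t
  set v := truncAction A B 𝕂 M e t - truncAction A B 𝕂 N e t
  have h1 : ‖v + 𝕂.toEuclideanLin y‖ ≤ ‖v‖ + κ * ‖y‖ :=
    (norm_add_le _ _).trans (add_le_add le_rfl (norm_toEuclideanLin_le_of_le S.norm_gain y))
  have h2 := pow_le_pow_left₀ (norm_nonneg _) h1 2
  have h3 : 1 ≤ κ ^ 2 := one_le_pow₀ S.one_le
  nlinarith [sq_nonneg (‖v‖ - κ * ‖y‖), mul_le_mul_of_nonneg_right h3 (sq_nonneg ‖v‖)]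

/-- Strong convexity of the cost is applied for each noise realisation, bounded below through the
feedforward, and integrated; only in expectation does the feedforward control `‖M - N‖`. -/
lemma StableSystem.surrogateCost_strongly_convex (S : StableSystem A B 𝕂 κB κ γ) (hα : 0 < α)
    (hc : CostClass α G c) (hD : NoiseLaw 𝒟 σ W) (M N : Params H du dx) {a b : ℝ} (ha : 0 ≤ a)
    (hb : 0 ≤ b) (hab : a + b = 1) :
    surrogateCost A B 𝕂 𝒟 c (a • M + b • N) ≤
      a * surrogateCost A B 𝕂 𝒟 c M + b * surrogateCost A B 𝕂 𝒟 c N -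
        a * b * (α * σ ^ 2 / (2 * κ ^ 2) / 2 * ‖M - N‖ ^ 2) := by
  have := hD.prob
  have hκ := S.kappa_pos
  set ν := Measure.pi fun _ : Fin (2 * H + 1) => 𝒟
  have hInt : ∀ N : Params H du dx, Integrable
      (fun w => truncCost A B 𝕂 c N (extendZero w) (2 * H + 1)) ν := fun N =>
    integrable_comp_noise continuous_extendZero.measurable hD.ae_extendZero
      (hc.continuous_truncCost_noise N _)
  have hintf : Integrable (fun w => ‖feedforward (M - N) (extendZero w) (2 * H + 1)‖ ^ 2) ν := by
    have hcf : Continuous (fun e : ℕ → EuclideanSpace ℝ (Fin dx) =>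
        ‖feedforward (M - N) e (2 * H + 1)‖ ^ 2) :=
      (((continuous_feedforward (H := H) (du := du) (2 * H + 1)).comp
        (continuous_const (y := M - N) |>.prodMk continuous_id)).norm).pow 2
    exact integrable_comp_noise continuous_extendZero.measurable hD.ae_extendZero hcf
  have hpt : ∀ w : Fin (2 * H + 1) → EuclideanSpace ℝ (Fin dx),
      truncCost A B 𝕂 c (a • M + b • N) (extendZero w) (2 * H + 1) ≤
        a * truncCost A B 𝕂 c M (extendZero w) (2 * H + 1) +
        b * truncCost A B 𝕂 c N (extendZero w) (2 * H + 1) -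
        a * b * (α / (4 * κ ^ 2)) * ‖feedforward (M - N) (extendZero w) (2 * H + 1)‖ ^ 2 := by
    intro w
    rw [truncCost, truncState_affine _ _ _ _ hab, truncAction_affine _ _ _ _ hab]
    refine (hc.strong_convexity _ _ _ _ ha hb hab).trans ?_
    have h1 := S.norm_feedforward_sub_sq_le M N (extendZero w) (2 * H + 1)
    have h2 := mul_le_mul_of_nonneg_left h1 (show 0 ≤ a * b * (α / (4 * κ ^ 2)) by positivity)
    rw [truncCost, truncCost]
    refine sub_le_sub_left (h2.trans (le_of_eq ?_)) _
    field_simp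
    ring
  have hsum : Integrable (fun w => a * truncCost A B 𝕂 c M (extendZero w) (2 * H + 1) +
      b * truncCost A B 𝕂 c N (extendZero w) (2 * H + 1)) ν :=
    ((hInt M).const_mul a).add ((hInt N).const_mul b)
  have h1 := integral_mono (hInt _) (hsum.sub (hintf.const_mul (a * b * (α / (4 * κ ^ 2))))) hpt
  simp only [Pi.sub_apply] at h1
  rw [integral_sub hsum (hintf.const_mul _),
    integral_add ((hInt M).const_mul a) ((hInt N).const_mul b), integral_const_mul,
    integral_const_mul, integral_const_mul] at h1
  rw [surrogateCost_eq, surrogateCost_eq, surrogateCost_eq]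
  have h2 := mul_le_mul_of_nonneg_left (hD.le_integral_feedforward_sq (M - N))
    (show 0 ≤ a * b * (α / (4 * κ ^ 2)) by positivity)
  have e : a * b * (α / (4 * κ ^ 2)) * (σ ^ 2 * ‖M - N‖ ^ 2) =
      a * b * (α * σ ^ 2 / (2 * κ ^ 2) / 2 * ‖M - N‖ ^ 2) := by
    field_simp
    ring
  rw [e] at h2
  linarith

end Surrogate

/-! ### Regret decomposition -/

section Regret

lemma abs_integral_sub_const_le {X : Type*} [MeasurableSpace X] {μ : Measure X}
    [IsProbabilityMeasure μ] {f : X → ℝ} (hf : Integrable f μ) {a C : ℝ}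
    (h : ∀ᵐ x ∂μ, |f x - a| ≤ C) : |∫ x, f x ∂μ - a| ≤ C := by
  have e : ∫ x, f x ∂μ - a = ∫ x, (f x - a) ∂μ := by
    rw [integral_sub hf (integrable_const a)]
    simp
  rw [e, ← Real.norm_eq_abs]
  have := norm_integral_le_of_norm_le_const (f := fun x => f x - a) (C := C) h
  simpa using this

lemma abs_integral_sub_integral_le {X : Type*} [MeasurableSpace X] {μ : Measure X}
    [IsProbabilityMeasure μ] {f g : X → ℝ} (hf : Integrable f μ) (hg : Integrable g μ) {C : ℝ}
    (h : ∀ᵐ x ∂μ, |f x - g x| ≤ C) : |∫ x, f x ∂μ - ∫ x, g x ∂μ| ≤ C := by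
  rw [← integral_sub hf hg, ← Real.norm_eq_abs]
  have := norm_integral_le_of_norm_le_const (f := fun x => f x - g x) (C := C) h
  simpa using this

/-- Summation of per-step errors: crude ones up to time `m`, and then ones of order `1 / T`
and `1 / t`. -/
lemma sum_step_errors_le {g : ℕ → ℝ} {T m : ℕ} (hT : 1 ≤ T) {X Y Z : ℝ} (hX : 0 ≤ X) (hY : 0 ≤ Y)
    (hZ : 0 ≤ Z) (h1 : ∀ t, 1 ≤ t → t ≤ T → t ≤ m → g t ≤ X)
    (h2 : ∀ t, 1 ≤ t → t ≤ T → m < t → g t ≤ Y * (1 / T) + Z * (t : ℝ)⁻¹) :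
    ∑ t ∈ Finset.Icc 1 T, g t ≤ m * X + Y + Z * (1 + Real.log T) := by
  have hT0 : (0 : ℝ) < T := by exact_mod_cast hT
  calc _ ≤ ∑ t ∈ Finset.Icc 1 T,
        ((if t ≤ m then X else 0) + Y * (1 / T) + Z * (t : ℝ)⁻¹) := by
        refine Finset.sum_le_sum fun t ht => ?_
        obtain ⟨ht1, ht2⟩ := Finset.mem_Icc.mp ht
        have hn : 0 ≤ Y * (1 / T) + Z * (t : ℝ)⁻¹ := by positivity
        split_ifs with hm
        · linarith [h1 t ht1 ht2 hm]
        · linarith [h2 t ht1 ht2 (by omega)]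
    _ = ∑ t ∈ Finset.Icc 1 T, (if t ≤ m then X else 0) + Y +
        Z * ∑ t ∈ Finset.Icc 1 T, (t : ℝ)⁻¹ := by
        rw [Finset.sum_add_distrib, Finset.sum_add_distrib, Finset.mul_sum, Finset.sum_const,
          Nat.card_Icc, nsmul_eq_mul, Nat.add_sub_cancel]
        congr 2
        field_simp
    _ ≤ _ := by
        have h3 : ∑ t ∈ Finset.Icc 1 T, (if t ≤ m then X else 0) ≤ m * X := by
          rw [← Finset.sum_filter, Finset.sum_const, nsmul_eq_mul]
          have : (Finset.filter (fun t => t ≤ m) (Finset.Icc 1 T)).card ≤ m := by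
            calc _ ≤ (Finset.Icc 1 m).card := Finset.card_le_card fun t ht => by
                  simp only [Finset.mem_filter, Finset.mem_Icc] at ht ⊢
                  omega
              _ = m := by simp
          gcongr
        have h4 := mul_le_mul_of_nonneg_left (sum_inv_le_one_add_log T) hZ
        linarith

variable {dx du T : ℕ} {A : Matrix (Fin dx) (Fin dx) ℝ} {B : Matrix (Fin dx) (Fin du) ℝ}
  {𝕂 K : Matrix (Fin du) (Fin dx) ℝ} {κB κ γ W σ α G θ : ℝ}
  {𝒟 : Measure (EuclideanSpace ℝ (Fin dx))} {Ω : Type*} [MeasurableSpace Ω] {P : Measure Ω}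
  {w : ℕ → Ω → EuclideanSpace ℝ (Fin dx)}

lemma StableSystem.abs_surrogateCost_sub_le {H : ℕ} (S : StableSystem A B 𝕂 κB κ γ)
    (hD : NoiseLaw 𝒟 σ W)
    {c : EuclideanSpace ℝ (Fin dx) → EuclideanSpace ℝ (Fin du) → ℝ} (hc : CostClass α G c)
    {M : Params H du dx} (hM : M ∈ feasible H du dx κB κ γ) :
    |surrogateCost A B 𝕂 𝒟 c M - c 0 0| ≤ 2 * G * (W * stateGain κB κ γ) ^ 2 := by
  have := hD.prob
  rw [surrogateCost_eq]
  refine abs_integral_sub_const_le (integrable_comp_noise continuous_extendZero.measurable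
    hD.ae_extendZero (hc.continuous_truncCost_noise M _)) ?_
  filter_upwards [hD.ae_extendZero] with v hv
  obtain ⟨h1, h2⟩ := S.trunc_bound hM hv (2 * H + 1)
  exact hc.abs_sub_zero_le h1 h2

lemma NoiseLaw.ae_noise (hD : NoiseLaw 𝒟 σ W) (hw : ∀ t, Measurable (w t))
    (hlaw : ∀ t, P.map (w t) = 𝒟) : ∀ᵐ ω ∂P, ∀ s, ‖w s ω‖ ≤ W := by
  rw [ae_all_iff]
  intro s
  exact ae_of_ae_map (hw s).aemeasurable (by rw [hlaw s]; exact hD.bounded)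

variable [IsProbabilityMeasure P]

/-- Expected cost at time `t` against the surrogate cost: a crude bound valid at all times. -/
lemma StableSystem.crude_gap {H : ℕ} (S : StableSystem A B 𝕂 κB κ γ) (hD : NoiseLaw 𝒟 σ W)
    (hw : ∀ t, Measurable (w t)) (hlaw : ∀ t, P.map (w t) = 𝒟)
    {c : EuclideanSpace ℝ (Fin dx) → EuclideanSpace ℝ (Fin du) → ℝ} (hc : CostClass α G c)
    {M : Params H du dx} (hM : M ∈ feasible H du dx κB κ γ)
    {x : (ℕ → EuclideanSpace ℝ (Fin dx)) → EuclideanSpace ℝ (Fin dx)}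
    {u : (ℕ → EuclideanSpace ℝ (Fin dx)) → EuclideanSpace ℝ (Fin du)}
    (hx : Continuous x) (hu : Continuous u)
    (hb : ∀ e, (∀ s, ‖e s‖ ≤ W) → ‖x e‖ ≤ W * stateGain κB κ γ ∧ ‖u e‖ ≤ W * stateGain κB κ γ) :
    |∫ ω, c (x fun s => w s ω) (u fun s => w s ω) ∂P - surrogateCost A B 𝕂 𝒟 c M| ≤
      4 * G * (W * stateGain κB κ γ) ^ 2 := by
  have hae := hD.ae_noise hw hlaw
  have hcont : Continuous (fun e => c (x e) (u e)) := hc.continuous.comp (hx.prodMk hu)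
  have h1 : |∫ ω, c (x fun s => w s ω) (u fun s => w s ω) ∂P - c 0 0| ≤
      2 * G * (W * stateGain κB κ γ) ^ 2 := by
    refine abs_integral_sub_const_le
      (integrable_comp_noise (measurable_pi_lambda _ fun s => hw s) hae hcont) ?_
    filter_upwards [hae] with ω hω
    exact hc.abs_sub_zero_le (hb _ hω).1 (hb _ hω).2
  have h2 := S.abs_surrogateCost_sub_le hD hc hM
  rw [abs_sub_comm] at h2
  have := abs_sub_le (∫ ω, c (x fun s => w s ω) (u fun s => w s ω) ∂P) (c 0 0)
    (surrogateCost A B 𝕂 𝒟 c M)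
  linarith

/-- Expected cost at time `t` against the surrogate cost, given a pathwise comparison. -/
lemma StableSystem.fine_gap {H : ℕ} (S : StableSystem A B 𝕂 κB κ γ) (hD : NoiseLaw 𝒟 σ W)
    (hw : ∀ t, Measurable (w t)) (hlaw : ∀ t, P.map (w t) = 𝒟) (hind : iIndepFun w P)
    {c : EuclideanSpace ℝ (Fin dx) → EuclideanSpace ℝ (Fin du) → ℝ} (hc : CostClass α G c)
    {M : Params H du dx} (hM : M ∈ feasible H du dx κB κ γ)
    {x : (ℕ → EuclideanSpace ℝ (Fin dx)) → EuclideanSpace ℝ (Fin dx)}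
    {u : (ℕ → EuclideanSpace ℝ (Fin dx)) → EuclideanSpace ℝ (Fin du)}
    (hx : Continuous x) (hu : Continuous u)
    (hb : ∀ e, (∀ s, ‖e s‖ ≤ W) → ‖x e‖ ≤ W * stateGain κB κ γ ∧ ‖u e‖ ≤ W * stateGain κB κ γ)
    {t : ℕ} (ht : 2 * H + 1 < t) {ε : ℝ}
    (hε : ∀ e, (∀ s, ‖e s‖ ≤ W) → ‖x e - truncState A B 𝕂 M e t‖ +
      ‖u e - truncAction A B 𝕂 M e t‖ ≤ ε) :
    |∫ ω, c (x fun s => w s ω) (u fun s => w s ω) ∂P - surrogateCost A B 𝕂 𝒟 c M| ≤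
      G * (W * stateGain κB κ γ) * ε := by
  have hae := hD.ae_noise hw hlaw
  have hwm : Measurable (fun ω s => w s ω) := measurable_pi_lambda _ fun s => hw s
  have hcont : Continuous (fun e => c (x e) (u e)) := hc.continuous.comp (hx.prodMk hu)
  have hG := hc.G_nonneg
  have hW := hD.W_nonneg
  have hg := S.stateGain_pos
  rw [surrogateCost_eq_expectation hw hlaw hind hc M ht.le]
  refine abs_integral_sub_integral_le (integrable_comp_noise hwm hae hcont)
    (integrable_comp_noise hwm hae (hc.continuous_truncCost_noise M t)) ?_
  filter_upwards [hae] with ω hω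
  obtain ⟨h1, h2⟩ := S.trunc_bound hM hω t
  refine (hc.abs_sub_le (hb _ hω).1 h1 (hb _ hω).2 h2).trans ?_
  exact mul_le_mul_of_nonneg_left (hε _ hω) (by positivity)

/-- The expected cost of the disturbance-action controller at time `t`. -/
def dapStepCost {H : ℕ} (A : Matrix (Fin dx) (Fin dx) ℝ) (B : Matrix (Fin dx) (Fin du) ℝ)
    (𝕂 : Matrix (Fin du) (Fin dx) ℝ) (P : Measure Ω) (w : ℕ → Ω → EuclideanSpace ℝ (Fin dx))
    (c : EuclideanSpace ℝ (Fin dx) → EuclideanSpace ℝ (Fin du) → ℝ) (M : ℕ → Params H du dx)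
    (t : ℕ) : ℝ :=
  ∫ ω, c (states A B (dapPolicy 𝕂 M fun s => w s ω) (fun s => w s ω) t)
    (dapPolicy 𝕂 M (fun s => w s ω) t
      (states A B (dapPolicy 𝕂 M fun s => w s ω) (fun s => w s ω) t)) ∂P

/-- The expected cost of the linear controller at time `t`. -/
def linearStepCost (A : Matrix (Fin dx) (Fin dx) ℝ) (B : Matrix (Fin dx) (Fin du) ℝ)
    (K : Matrix (Fin du) (Fin dx) ℝ) (P : Measure Ω) (w : ℕ → Ω → EuclideanSpace ℝ (Fin dx))
    (c : EuclideanSpace ℝ (Fin dx) → EuclideanSpace ℝ (Fin du) → ℝ) (t : ℕ) : ℝ :=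
  ∫ ω, c (states A B (linearPolicy K) (fun s => w s ω) t)
    (linearPolicy K t (states A B (linearPolicy K) (fun s => w s ω) t)) ∂P

lemma expectedCost_dap {H : ℕ} (hD : NoiseLaw 𝒟 σ W) (hw : ∀ t, Measurable (w t))
    (hlaw : ∀ t, P.map (w t) = 𝒟)
    {c : ℕ → EuclideanSpace ℝ (Fin dx) → EuclideanSpace ℝ (Fin du) → ℝ}
    (hc : ∀ t, 1 ≤ t → t ≤ T → CostClass α G (c t)) (M : ℕ → Params H du dx) :
    expectedCost A B P w c T (dapPolicy 𝕂 M) =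
      ∑ t ∈ Finset.Icc 1 T, dapStepCost A B 𝕂 P w (c t) M t := by
  refine integral_finsetSum _ fun t ht => ?_
  obtain ⟨h1, h2⟩ := Finset.mem_Icc.mp ht
  have hcont : Continuous (fun e => c t (states A B (dapPolicy 𝕂 M e) e t)
      (dapPolicy 𝕂 M e t (states A B (dapPolicy 𝕂 M e) e t))) :=
    (hc t h1 h2).continuous.comp ((continuous_states_dap M h1).prodMk (continuous_action_dap M h1))
  exact integrable_comp_noise (measurable_pi_lambda _ fun s => hw s) (hD.ae_noise hw hlaw) hcont

lemma expectedCost_linear (hD : NoiseLaw 𝒟 σ W) (hw : ∀ t, Measurable (w t))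
    (hlaw : ∀ t, P.map (w t) = 𝒟)
    {c : ℕ → EuclideanSpace ℝ (Fin dx) → EuclideanSpace ℝ (Fin du) → ℝ}
    (hc : ∀ t, 1 ≤ t → t ≤ T → CostClass α G (c t)) :
    expectedCost A B P w c T (fun _ => linearPolicy K) =
      ∑ t ∈ Finset.Icc 1 T, linearStepCost A B K P w (c t) t := by
  refine integral_finsetSum _ fun t ht => ?_
  obtain ⟨h1, h2⟩ := Finset.mem_Icc.mp ht
  have hcont : Continuous (fun e => c t (states A B (linearPolicy K) e t)
      (linearPolicy K t (states A B (linearPolicy K) e t))) :=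
    (hc t h1 h2).continuous.comp
      ((continuous_states_linear h1).prodMk (continuous_action_linear h1))
  exact integrable_comp_noise (measurable_pi_lambda _ fun s => hw s) (hD.ae_noise hw hlaw) hcont

/-- Up to time `2H + 1` only boundedness is used. Later the drift hypothesis applies: `s ≥ t - 1 -
H` and `t ≥ 2H + 2` imply `t ≤ 2s`. -/
lemma StableSystem.sum_dap_gap_le {H : ℕ} (S : StableSystem A B 𝕂 κB κ γ) (hT : 1 ≤ T)
    (hH : κ ^ 2 * (1 - γ) ^ H ≤ 1 / T) (hD : NoiseLaw 𝒟 σ W) (hw : ∀ t, Measurable (w t))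
    (hlaw : ∀ t, P.map (w t) = 𝒟) (hind : iIndepFun w P)
    {c : ℕ → EuclideanSpace ℝ (Fin dx) → EuclideanSpace ℝ (Fin du) → ℝ}
    (hc : ∀ t, 1 ≤ t → t ≤ T → CostClass α G (c t)) {M : ℕ → Params H du dx}
    (hM : ∀ t, 1 ≤ t → t ≤ T → M t ∈ feasible H du dx κB κ γ) {Z : ℝ} (hZ : 0 ≤ Z)
    (hδ : ∀ s t, 1 ≤ s → s ≤ t → t ≤ T → t ≤ s + (H + 1) → t ≤ 2 * s →
      ‖M s - M t‖ ≤ Z * (t : ℝ)⁻¹) :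
    ∑ t ∈ Finset.Icc 1 T,
        (dapStepCost A B 𝕂 P w (c t) M t - surrogateCost A B 𝕂 𝒟 (c t) (M t)) ≤
      (2 * H + 1 : ℕ) * (4 * G * (W * stateGain κB κ γ) ^ 2) +
        G * (W * stateGain κB κ γ) ^ 2 * (1 + κ) +
        (G * (W * stateGain κB κ γ) * (lipGain κB κ γ * (W * H * Z))) * (1 + Real.log T) := by
  have hκ := S.kappa_pos
  have hg := S.stateGain_pos
  have hl := S.lipGain_pos
  have hW := hD.W_nonneg
  have hG := (hc 1 le_rfl hT).G_nonneg
  refine sum_step_errors_le hT (by positivity) (by positivity) (by positivity) ?_ ?_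
  · intro t ht htT _
    exact le_of_abs_le (S.crude_gap hD hw hlaw (hc t ht htT) (hM t ht htT)
      (x := fun e => states A B (dapPolicy 𝕂 M e) e t)
      (u := fun e => dapPolicy 𝕂 M e t (states A B (dapPolicy 𝕂 M e) e t))
      (continuous_states_dap M ht) (continuous_action_dap M ht)
      fun e he => S.dap_bound he hM ht htT)
  · intro t ht htT hHt
    have key := le_of_abs_le (S.fine_gap hD hw hlaw hind (hc t ht htT) (hM t ht htT)
      (x := fun e => states A B (dapPolicy 𝕂 M e) e t)
      (u := fun e => dapPolicy 𝕂 M e t (states A B (dapPolicy 𝕂 M e) e t))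
      (continuous_states_dap M ht) (continuous_action_dap M ht)
      (fun e he => S.dap_bound he hM ht htT) hHt
      fun e he => S.dap_compare he hM hHt htT
        fun s hs hst => hδ s t (by omega) hst htT (by omega) (by omega))
    refine le_trans key ?_
    have h1 : (1 + κ) * (κ ^ 2 * (1 - γ) ^ H * (W * stateGain κB κ γ)) ≤
        (1 + κ) * (1 / T * (W * stateGain κB κ γ)) := by gcongr
    calc _ ≤ G * (W * stateGain κB κ γ) * ((1 + κ) * (1 / T * (W * stateGain κB κ γ)) +
          lipGain κB κ γ * (W * H * (Z * (t : ℝ)⁻¹))) := by gcongr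
      _ = _ := by ring

lemma StableSystem.sum_linear_gap_le {H : ℕ} (S : StableSystem A B 𝕂 κB κ γ) (hT : 1 ≤ T)
    (hH : κ ^ 2 * (1 - γ) ^ H ≤ 1 / T) (hD : NoiseLaw 𝒟 σ W) (hw : ∀ t, Measurable (w t))
    (hlaw : ∀ t, P.map (w t) = 𝒟) (hind : iIndepFun w P)
    {c : ℕ → EuclideanSpace ℝ (Fin dx) → EuclideanSpace ℝ (Fin du) → ℝ}
    (hc : ∀ t, 1 ≤ t → t ≤ T → CostClass α G (c t)) (hK : DiagStronglyStable A B κ γ K) :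
    ∑ t ∈ Finset.Icc 1 T, (surrogateCost A B 𝕂 𝒟 (c t) (imitation A B 𝕂 K H) -
        linearStepCost A B K P w (c t) t) ≤
      (2 * H + 1 : ℕ) * (4 * G * (W * stateGain κB κ γ) ^ 2) +
        G * (W * stateGain κB κ γ) ^ 2 * (1 + κ + 2 * κ * lipGain κB κ γ) +
        0 * (1 + Real.log T) := by
  have hκ := S.kappa_pos
  have hg := S.stateGain_pos
  have hl := S.lipGain_pos
  have hW := hD.W_nonneg
  have hG := (hc 1 le_rfl hT).G_nonneg
  have hN := S.imitation_feasible hK (H := H)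
  refine sum_step_errors_le hT (by positivity) (by positivity) le_rfl ?_ ?_
  · intro t ht htT _
    rw [← neg_sub]
    exact neg_le_of_neg_le (neg_le_of_abs_le (S.crude_gap hD hw hlaw (hc t ht htT) hN
      (x := fun e => states A B (linearPolicy K) e t)
      (u := fun e => linearPolicy K t (states A B (linearPolicy K) e t))
      (continuous_states_linear ht) (continuous_action_linear ht)
      fun e he => S.linear_bound hK he ht))
  · intro t ht htT hHt
    rw [← neg_sub]
    have key := neg_le_of_neg_le (neg_le_of_abs_le
      (S.fine_gap hD hw hlaw hind (hc t ht htT) hN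
      (x := fun e => states A B (linearPolicy K) e t)
      (u := fun e => linearPolicy K t (states A B (linearPolicy K) e t))
      (continuous_states_linear ht) (continuous_action_linear ht)
      (fun e he => S.linear_bound hK he ht) hHt
      fun e he => S.linear_compare hK he hHt))
    refine le_trans key ?_
    calc _ ≤ G * (W * stateGain κB κ γ) *
          ((1 + κ + 2 * κ * lipGain κB κ γ) * (1 / T * (W * stateGain κB κ γ))) := by gcongr
      _ = _ := by ring

lemma IsGradientRun.feasible {H : ℕ}
    {c : ℕ → EuclideanSpace ℝ (Fin dx) → EuclideanSpace ℝ (Fin du) → ℝ} {η : ℕ → ℝ}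
    {M : ℕ → Params H du dx} (h : IsGradientRun A B 𝕂 κB κ γ 𝒟 c T η M) {t : ℕ} (ht : 1 ≤ t)
    (htT : t ≤ T) : M t ∈ feasible H du dx κB κ γ := by
  rcases Nat.lt_or_ge 1 t with h1 | h1
  · obtain ⟨s, rfl⟩ := Nat.exists_eq_add_of_le' ht
    exact (h.2 s (by omega) (by omega)).1
  · rw [show t = 1 by omega]
    exact h.1

/-- The regret bound, with explicit dependence on the horizon. -/
lemma regret_le {H : ℕ} (S : StableSystem A B 𝕂 κB κ γ) (hσ : 0 < σ) (hα : 0 < α) (hT : 1 ≤ T)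
    (hH : κ ^ 2 * (1 - γ) ^ H ≤ 1 / T)
    (hD : NoiseLaw 𝒟 σ W) (hw : ∀ t, Measurable (w t)) (hlaw : ∀ t, P.map (w t) = 𝒟)
    (hind : iIndepFun w P)
    {c : ℕ → EuclideanSpace ℝ (Fin dx) → EuclideanSpace ℝ (Fin du) → ℝ}
    (hc : ∀ t, 1 ≤ t → t ≤ T → CostClass α G (c t)) (hθ : 2 * κ ^ 2 ≤ θ)
    {M : ℕ → Params H du dx}
    (hrun : IsGradientRun A B 𝕂 κB κ γ 𝒟 c T (fun t => θ / (α * σ ^ 2 * t)) M)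
    (hK : DiagStronglyStable A B κ γ K) :
    expectedCost A B P w c T (dapPolicy 𝕂 M) -
        expectedCost A B P w c T (fun _ => linearPolicy K) ≤
      8 * G * (W * stateGain κB κ γ) ^ 2 * (2 * H + 1) +
      G * (W * stateGain κB κ γ) ^ 2 * (2 + 2 * κ + 2 * κ * lipGain κB κ γ) +
      (G * (W * stateGain κB κ γ) * (lipGain κB κ γ * (W * H *
        ((H + 1) * (4 * (θ / (α * σ ^ 2)) * surrogateLip κB κ γ G W H))))) * (1 + Real.log T) +
      θ / (2 * (α * σ ^ 2)) * surrogateLip κB κ γ G W H ^ 2 * (1 + Real.log T) := by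
  have hκ := S.kappa_pos
  have hG := (hc 1 le_rfl hT).G_nonneg
  have hβ : 0 < α * σ ^ 2 := by positivity
  have hθ0 : 0 < θ := lt_of_lt_of_le (by positivity) hθ
  have hℓ : 0 ≤ surrogateLip κB κ γ G W H := S.surrogateLip_nonneg hG
  have hM : ∀ t, 1 ≤ t → t ≤ T → M t ∈ feasible H du dx κB κ γ := fun t => hrun.feasible
  let f : ℕ → Params H du dx → ℝ := fun t => surrogateCost A B 𝕂 𝒟 (c t)
  have hgrad : ∀ t, 1 ≤ t → t ≤ T → ‖gradient (f t) (M t)‖ ≤ surrogateLip κB κ γ G W H := by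
    intro t ht htT
    obtain ⟨f', h1, h2⟩ := S.surrogateCost_hasFDerivAt (hc t ht htT) hD (hM t ht htT)
    rw [norm_gradient_eq, h1.fderiv]
    exact h2
  have hogd : ∑ t ∈ Finset.Icc 1 T, (f t (M t) - f t (imitation A B 𝕂 K H)) ≤
      θ / (2 * (α * σ ^ 2)) * surrogateLip κB κ γ G W H ^ 2 * (1 + Real.log T) := by
    refine gradient_descent_regret (convex_feasible κB κ γ) hθ0 hβ hT (S.imitation_feasible hK)
      (g := fun t => gradient (f t) (M t)) hrun.2 hgrad fun t ht htT => ?_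
    obtain ⟨f', h1, -⟩ := S.surrogateCost_hasFDerivAt (hc t ht htT) hD (hM t ht htT)
    have h2 := sub_le_inner_gradient_of_strongly_convex (y := imitation A B 𝕂 K H)
      (μ := α * σ ^ 2 / (2 * κ ^ 2)) h1.differentiableAt fun s hs hs1 =>
        S.surrogateCost_strongly_convex hα (hc t ht htT) hD (M t) _ (by linarith) hs.le (by ring)
    refine h2.trans (sub_le_sub_left ?_ _)
    -- The modulus `ασ²/(2κ²)` is at least `ασ²/θ` because `θ ≥ 2κ²`.
    gcongr
  -- `Z` is the window length `H + 1` times the bound on `t` times a single step.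
  have hdap := S.sum_dap_gap_le hT hH hD hw hlaw hind hc hM
    (Z := (H + 1) * (4 * (θ / (α * σ ^ 2)) * surrogateLip κB κ γ G W H)) (by positivity) <| by
    intro s t hs hst htT h1 h2
    refine (norm_iterate_sub_le hθ0 hβ hM (g := fun t => gradient (f t) (M t))
      (fun t h1 h2 => (hrun.2 t h1 h2).2) hgrad hs hst htT h2).trans ?_
    have : ((t - s : ℕ) : ℝ) ≤ H + 1 := by exact_mod_cast (show t - s ≤ H + 1 by omega)
    rw [mul_assoc ((H : ℝ) + 1)]
    gcongr
  have hlin := S.sum_linear_gap_le hT hH hD hw hlaw hind hc hK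
  rw [expectedCost_dap hD hw hlaw hc, expectedCost_linear hD hw hlaw hc]
  rw [Finset.sum_sub_distrib] at hogd hdap hlin
  push_cast at hdap hlin
  linarith

end Regret

/-! ### Collecting the constants -/

section Constants

variable {κB κ γ : ℝ}

/-- `horizonGain * log T` bounds the horizon for `T ≥ 2`. -/
def horizonGain (κ γ : ℝ) : ℝ := γ⁻¹ * (1 + 4 * κ) + 2

/-- The constant of the final regret bound. -/
def regretGain (κB κ γ : ℝ) : ℝ :=
  stateGain κB κ γ ^ 2 * (3072 * (2 * horizonGain κ γ + 2) +
    768 * (2 + 2 * κ + 2 * κ * lipGain κB κ γ) +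
    24 * lipGain κB κ γ ^ 2 *
      (8 * horizonGain κ γ ^ 2 * (horizonGain κ γ + 2) + 4 * horizonGain κ γ ^ 2))

lemma half_le_log {T : ℕ} (hT : 2 ≤ T) : 1 / 2 ≤ Real.log T := by
  have h1 := Real.log_two_gt_d9
  have h2 : Real.log 2 ≤ Real.log T :=
    Real.log_le_log (by norm_num) (by exact_mod_cast hT)
  linarith

/-- `log κ ≤ κ` and `1 ≤ 2 log T` absorb both the `κ`-term and the rounding into a multiple of `log
T`. -/
lemma horizon_le (hκ : 1 ≤ κ) (hγ : 0 < γ) {T : ℕ} (hT : 2 ≤ T) :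
    (horizon κ γ T : ℝ) ≤ horizonGain κ γ * Real.log T := by
  have hlog := half_le_log hT
  have hT0 : (1 : ℝ) ≤ T := by exact_mod_cast (show 1 ≤ T by omega)
  have hγ' : 0 < γ⁻¹ := inv_pos.mpr hγ
  have hκ0 : 0 < κ := by linarith
  have h1 : Real.log (T * κ ^ 2) = Real.log T + 2 * Real.log κ := by
    rw [Real.log_mul (by positivity) (by positivity), Real.log_pow]
    norm_num
  have h2 : Real.log κ ≤ κ := (Real.log_le_sub_one_of_pos hκ0).trans (by linarith)
  have h3 : 0 ≤ Real.log κ := Real.log_nonneg hκ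
  have h4 : (horizon κ γ T : ℝ) < γ⁻¹ * Real.log (T * κ ^ 2) + 1 :=
    Nat.ceil_lt_add_one (by rw [h1]; positivity)
  have h5 : Real.log (T * κ ^ 2) ≤ (1 + 4 * κ) * Real.log T := by
    rw [h1]
    nlinarith
  have h6 := mul_le_mul_of_nonneg_left h5 hγ'.le
  unfold horizonGain
  nlinarith

lemma le_log_pow_seven {x C : ℝ} {k : ℕ} (hk : k ≤ 7) (hC : 0 ≤ C) (hx : 1 / 2 ≤ x) :
    C * x ^ k ≤ C * 2 ^ (7 - k) * x ^ 7 := by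
  have h1 : (1 : ℝ) ≤ (2 * x) ^ (7 - k) := one_le_pow₀ (by linarith)
  have hx0 : 0 ≤ x := by linarith
  calc C * x ^ k ≤ C * x ^ k * (2 * x) ^ (7 - k) := le_mul_of_one_le_right (by positivity) h1
    _ = C * 2 ^ (7 - k) * (x ^ k * x ^ (7 - k)) := by rw [mul_pow]; ring
    _ = _ := by rw [← pow_add, Nat.add_sub_cancel' hk]

/-- Collects the terms of the regret bound. -/
lemma regret_terms_le {g l h h' θ R r Q x : ℝ} (hg : 0 < g) (hl : 0 < l) (hκ : 0 ≤ κ)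
    (hθ : 1 ≤ θ) (hr : r ≤ 6 * R) (hr0 : 0 ≤ r) (hR : 0 ≤ R) (hx : 1 / 2 ≤ x) (hh0 : 0 ≤ h)
    (hh' : 0 ≤ h') (hh : h ≤ h' * x)
    (hQ : Q = g ^ 2 * (3072 * (2 * h' + 2) + 768 * (2 + 2 * κ + 2 * κ * l) +
      24 * l ^ 2 * (8 * h' ^ 2 * (h' + 2) + 4 * h' ^ 2))) :
    8 * (r * g ^ 2) * (2 * h + 1) + r * g ^ 2 * (2 + 2 * κ + 2 * κ * l) +
      8 * θ * R * g ^ 2 * l ^ 2 * h ^ 2 * (h + 1) * (1 + x) +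
      2 * θ * R * g ^ 2 * l ^ 2 * h ^ 2 * (1 + x) ≤ Q * θ * R * x ^ 7 := by
  have hx0 : 0 < x := by linarith
  have hrR : r ≤ 6 * (θ * R) := hr.trans (by nlinarith)
  have hθ0 : 0 ≤ θ := by linarith
  -- Raising `x^k` to `x^7` costs `2^(7-k)`. The terms have degrees 1, 0, 4 and 3, giving `48·64 =
  -- 3072`, `6·128 = 768`, `3·8 = 24` and `6·16 = 24·4`.
  have t1 : 8 * (r * g ^ 2) * (2 * h + 1) ≤ θ * R * g ^ 2 * (3072 * (2 * h' + 2)) * x ^ 7 := by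
    calc _ ≤ 8 * (6 * (θ * R) * g ^ 2) * ((2 * h' + 2) * x) := by
          gcongr
          linarith
      _ = (θ * R * g ^ 2 * (48 * (2 * h' + 2))) * x ^ 1 := by ring
      _ ≤ _ := le_log_pow_seven (by norm_num) (by positivity) hx
      _ = _ := by ring
  have t2 : r * g ^ 2 * (2 + 2 * κ + 2 * κ * l) ≤
      θ * R * g ^ 2 * (768 * (2 + 2 * κ + 2 * κ * l)) * x ^ 7 := by
    calc _ ≤ 6 * (θ * R) * g ^ 2 * (2 + 2 * κ + 2 * κ * l) := by gcongr
      _ = (θ * R * g ^ 2 * (6 * (2 + 2 * κ + 2 * κ * l))) * x ^ 0 := by ring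
      _ ≤ _ := le_log_pow_seven (by norm_num) (by positivity) hx
      _ = _ := by ring
  have t3 : 8 * θ * R * g ^ 2 * l ^ 2 * h ^ 2 * (h + 1) * (1 + x) ≤
      θ * R * g ^ 2 * (24 * l ^ 2 * (8 * h' ^ 2 * (h' + 2))) * x ^ 7 := by
    calc _ ≤ 8 * θ * R * g ^ 2 * l ^ 2 * (h' * x) ^ 2 * ((h' + 2) * x) * (3 * x) := by
          gcongr <;> linarith
      _ = (θ * R * g ^ 2 * (3 * l ^ 2 * (8 * h' ^ 2 * (h' + 2)))) * x ^ 4 := by ring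
      _ ≤ _ := le_log_pow_seven (by norm_num) (by positivity) hx
      _ = _ := by ring
  have t4 : 2 * θ * R * g ^ 2 * l ^ 2 * h ^ 2 * (1 + x) ≤
      θ * R * g ^ 2 * (24 * l ^ 2 * (4 * h' ^ 2)) * x ^ 7 := by
    calc _ ≤ 2 * θ * R * g ^ 2 * l ^ 2 * (h' * x) ^ 2 * (3 * x) := by
          gcongr
          linarith
      _ = (θ * R * g ^ 2 * (6 * l ^ 2 * h' ^ 2)) * x ^ 3 := by ring
      _ ≤ _ := le_log_pow_seven (by norm_num) (by positivity) hx
      _ = _ := by ring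
  rw [hQ]
  linarith

end Constants

/-! ### One time step, and dimension zero -/

section DegenerateCases

variable {dx du H T : ℕ} {A : Matrix (Fin dx) (Fin dx) ℝ} {B : Matrix (Fin dx) (Fin du) ℝ}
  {𝕂 K : Matrix (Fin du) (Fin dx) ℝ} {Ω : Type*} [MeasurableSpace Ω] {P : Measure Ω}
  {w : ℕ → Ω → EuclideanSpace ℝ (Fin dx)}
  {c : ℕ → EuclideanSpace ℝ (Fin dx) → EuclideanSpace ℝ (Fin du) → ℝ}

/-- For `T = 1` the claimed bound is zero; at `x_1 = 0` without past noise both controllers play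
`0`. -/
lemma expectedCost_eq_of_one (M : ℕ → Params H du dx) :
    expectedCost A B P w c 1 (dapPolicy 𝕂 M) =
      expectedCost A B P w c 1 (fun _ => linearPolicy K) := by
  have h : ∀ v : ℕ → EuclideanSpace ℝ (Fin dx), dapInput M v 1 = 0 := fun v => by
    rw [dapInput_eq_sum_range]
    simp
  have h' : ∀ v : ℕ → EuclideanSpace ℝ (Fin dx), dapPolicy 𝕂 M v 1 0 = 0 := fun v => by
    rw [dapPolicy, ← dapInput, h, map_zero, neg_zero, add_zero]
  unfold expectedCost
  simp [states, h', linearPolicy]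

/-- Without state directions `α ≤ 6G` and `σ ≤ W` may fail, but then every action is `0`. -/
lemma expectedCost_eq_of_dim_zero (hdx : dx = 0) (M : ℕ → Params H du dx) :
    expectedCost A B P w c T (dapPolicy 𝕂 M) =
      expectedCost A B P w c T (fun _ => linearPolicy K) := by
  subst hdx
  have h0 : ∀ (L : Matrix (Fin du) (Fin 0) ℝ) (x : EuclideanSpace ℝ (Fin 0)),
      L.toEuclideanLin x = 0 := fun L x => by
    rw [Subsingleton.elim x 0, map_zero]
  have h1 : ∀ (v : ℕ → EuclideanSpace ℝ (Fin 0)) t x, dapPolicy 𝕂 M v t x = 0 := fun v t x => by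
    simp only [dapPolicy, h0, neg_zero, zero_add, ite_self, Finset.sum_const_zero]
  have h2 : ∀ t x, linearPolicy K t x = 0 := fun t x => by
    simp only [linearPolicy, h0, neg_zero]
  unfold expectedCost
  refine integral_congr_ae (Filter.Eventually.of_forall fun ω =>
    Finset.sum_congr rfl fun t _ => ?_)
  dsimp only
  rw [h1, h2, Subsingleton.elim (states A B (dapPolicy 𝕂 M fun s => w s ω) (fun s => w s ω) t)]

end DegenerateCases

/-! ### The constants as polynomials -/

section Polynomials

open MvPolynomial

/-- `feedforwardGain` as a polynomial in `γ⁻¹, κ_B, κ, d`. -/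
def feedforwardGainPoly : MvPolynomial (Fin 4) ℝ := X 2 ^ 3 * (X 1 + 2) * X 0

/-- `stateGain` as a polynomial in `γ⁻¹, κ_B, κ, d`. -/
def stateGainPoly : MvPolynomial (Fin 4) ℝ :=
  X 2 ^ 3 * X 0 * (1 + X 1 * feedforwardGainPoly) + feedforwardGainPoly

/-- `lipGain` as a polynomial in `γ⁻¹, κ_B, κ, d`. -/
def lipGainPoly : MvPolynomial (Fin 4) ℝ := (1 + X 2) * (X 2 ^ 2 * X 0 * X 1) + 1

/-- `horizonGain` as a polynomial in `γ⁻¹, κ_B, κ, d`. -/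
def horizonGainPoly : MvPolynomial (Fin 4) ℝ := X 0 * (1 + 4 * X 2) + 2

/-- `regretGain` as a polynomial in `γ⁻¹, κ_B, κ, d`. -/
def regretGainPoly : MvPolynomial (Fin 4) ℝ :=
  stateGainPoly ^ 2 * (3072 * (2 * horizonGainPoly + 2) +
    768 * (2 + 2 * X 2 + 2 * X 2 * lipGainPoly) +
    24 * lipGainPoly ^ 2 *
      (8 * horizonGainPoly ^ 2 * (horizonGainPoly + 2) + 4 * horizonGainPoly ^ 2))

lemma eval_regretGainPoly (κB κ γ d : ℝ) :
    eval ![γ⁻¹, κB, κ, d] regretGainPoly = regretGain κB κ γ := by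
  simp [regretGainPoly, regretGain, stateGainPoly, stateGain, lipGainPoly, lipGain,
    horizonGainPoly, horizonGain, feedforwardGainPoly, feedforwardGain]

end Polynomials

lemma regretGain_nonneg {dx du : ℕ} {A : Matrix (Fin dx) (Fin dx) ℝ}
    {B : Matrix (Fin dx) (Fin du) ℝ} {𝕂 : Matrix (Fin du) (Fin dx) ℝ} {κB κ γ : ℝ}
    (S : StableSystem A B 𝕂 κB κ γ) : 0 ≤ regretGain κB κ γ := by
  have := S.stateGain_pos
  have := S.lipGain_pos
  have := S.kappa_pos
  have := S.inv_pos
  unfold regretGain horizonGain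
  positivity

end OnlineControl

end

theorem theorem1 :
    ∃ p q : MvPolynomial (Fin 4) ℝ,
      ∀ (dx du : ℕ) (A : Matrix (Fin dx) (Fin dx) ℝ) (B : Matrix (Fin dx) (Fin du) ℝ)
        (κB κ γ σ W α G θ : ℝ) (T : ℕ)
        (Ω : Type*) [MeasurableSpace Ω] (P : Measure Ω) [IsProbabilityMeasure P]
        (𝒟 : Measure (EuclideanSpace ℝ (Fin dx)))
        (w : ℕ → Ω → EuclideanSpace ℝ (Fin dx))
        (c : ℕ → EuclideanSpace ℝ (Fin dx) → EuclideanSpace ℝ (Fin du) → ℝ)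
        (𝕂 : Matrix (Fin du) (Fin dx) ℝ)
        (M : ℕ → OnlineControl.Params (OnlineControl.horizon κ γ T) du dx),
      1 ≤ κ → 0 < γ → γ < 1 → 0 < σ → 0 < α → 1 ≤ T →
      OnlineControl.specNorm B ≤ κB →
      OnlineControl.NoiseLaw 𝒟 σ W →
      (∀ t, Measurable (w t)) → (∀ t, P.map (w t) = 𝒟) → iIndepFun w P →
      (∀ t, 1 ≤ t → t ≤ T → OnlineControl.CostClass α G (c t)) →
      OnlineControl.DiagStronglyStable A B κ γ 𝕂 →
      MvPolynomial.eval ![γ⁻¹, κB, κ, ((max dx du : ℕ) : ℝ)] p ≤ θ →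
      OnlineControl.IsGradientRun A B 𝕂 κB κ γ 𝒟 c T (fun t => θ / (α * σ ^ 2 * t)) M →
      ∀ K : Matrix (Fin du) (Fin dx) ℝ, OnlineControl.DiagStronglyStable A B κ γ K →
        OnlineControl.expectedCost A B P w c T (OnlineControl.dapPolicy 𝕂 M)
          - OnlineControl.expectedCost A B P w c T (fun _ => OnlineControl.linearPolicy K)
        ≤ MvPolynomial.eval ![γ⁻¹, κB, κ, ((max dx du : ℕ) : ℝ)] q * θ *
          (G ^ 2 * W ^ 4 / (α * σ ^ 2)) * Real.log T ^ 7 := by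
  -- Variable `2` is `κ`, so `p = 2κ²`, the value matching the strong convexity modulus. Neither
  -- polynomial involves the dimension.
  refine ⟨2 * MvPolynomial.X 2 ^ 2, OnlineControl.regretGainPoly, ?_⟩
  intro dx du A B κB κ γ σ W α G θ T Ω _ P _ 𝒟 w c 𝕂 M hκ hγ hγ1 hσ hα hT hB hD hw hlaw hind hc
    h𝕂 hθ hrun K hK
  rw [OnlineControl.eval_regretGainPoly]
  have hθ' : 2 * κ ^ 2 ≤ θ := by simpa using hθ
  have S : OnlineControl.StableSystem A B 𝕂 κB κ γ := ⟨hκ, hγ, hγ1, hB, h𝕂⟩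
  have hκ2 : 1 ≤ κ ^ 2 := one_le_pow₀ hκ
  have hθ1 : 1 ≤ θ := by linarith
  have hG := (hc 1 le_rfl hT).G_nonneg
  have hQ := OnlineControl.regretGain_nonneg S
  have hlog : 0 ≤ Real.log T := Real.log_nonneg (by exact_mod_cast hT)
  have hR : 0 ≤ G ^ 2 * W ^ 4 / (α * σ ^ 2) := by positivity
  have hrhs : 0 ≤ OnlineControl.regretGain κB κ γ * θ *
      (G ^ 2 * W ^ 4 / (α * σ ^ 2)) * Real.log T ^ 7 := by positivity
  rcases Nat.eq_zero_or_pos dx with hdx | hdx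
  · rw [OnlineControl.expectedCost_eq_of_dim_zero hdx, sub_self]
    exact hrhs
  rcases hT.eq_or_lt with rfl | hT2
  · rw [OnlineControl.expectedCost_eq_of_one, sub_self]
    exact hrhs
  have hα6 : α ≤ 6 * G := (hc 1 le_rfl hT).alpha_le hdx
  have hσW := hD.sigma_sq_le hdx
  -- Uses `ασ² ≤ 6GW²`, so the terms without `1/(ασ²)` fit the claimed scale.
  have hr : G * W ^ 2 ≤ 6 * (G ^ 2 * W ^ 4 / (α * σ ^ 2)) := by
    rw [← mul_div_assoc, le_div_iff₀ (by positivity)]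
    calc G * W ^ 2 * (α * σ ^ 2) ≤ G * W ^ 2 * (6 * G * W ^ 2) := by gcongr
      _ = _ := by ring
  refine (OnlineControl.regret_le S hσ hα hT
    (OnlineControl.one_sub_pow_horizon_le hκ hγ hγ1 hT) hD hw hlaw hind hc hθ' hrun hK).trans ?_
  have key := OnlineControl.regret_terms_le S.stateGain_pos S.lipGain_pos S.kappa_pos.le hθ1 hr
    (by positivity) hR (OnlineControl.half_le_log hT2)
    (Nat.cast_nonneg (OnlineControl.horizon κ γ T))
    (by have := S.inv_pos; have := S.kappa_pos; unfold OnlineControl.horizonGain; positivity)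
    (OnlineControl.horizon_le hκ hγ hT2) (Q := OnlineControl.regretGain κB κ γ) rfl
  refine le_trans (le_of_eq ?_) key
  unfold OnlineControl.surrogateLip
  field_simp
  ring
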